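/- Let $G$ be a second countable locally compact abelian Hausdorff group (written additively) and let $M\le H\le G$ be countable uniform lattices, i.e. discrete subgroups with compact quotients $G/M$, $G/H$. Let $\widehat H$ be the (compact) dual group of $H$, written additively, with Haar measure normalized to total mass $1$; for $h\in H$ put $\chi_h(\gamma)=(h,\gamma)$, $\gamma\in\widehat H$, so that $\{\chi_h\}_{h\in H}$ is an orthonormal basis of $L^2(\widehat H)$. Let $M^\perp=\{\gamma\in\widehat H:(m,\gamma)=1\text{ for all }m\in M\}=\{\mu_0^\perp=0,\mu_1^\perp,\dots,\mu_{r-1}^\perp\}$, a finite group of order $r$, and let $\Omega\subset\widehat H$ be a Borel section of $\widehat H/M^\perp$, i.e. a measurable set such that $\widehat H$ is the disjoint union of the sets $\mu_k^\perp+\Omega$, $k=0,\dots,r-1$. Let $\mathcal H$ be a complex separable Hilbert space (inner product linear in the first argument), let $\Pi$ be a map from $G$ to the bounded invertible operators on $\mathcal H$ with $\Pi(g+g')=\Pi(g)\Pi(g')$, and let $a\in\mathcal H$ be such that $\{\Pi(h)a\}_{h\in H}$ is a Riesz sequence. Put $\mathcal A_a=\overline{\operatorname{span}}\{\Pi(h)a:h\in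 H\}$ and let $\mathcal T_{H,a}:L^2(\widehat H)\to\mathcal A_a$ be the isomorphism $\sum_{h}\alpha_h\chi_h\mapsto\sum_h\alpha_h\Pi(h)a$. Let $b_1,\dots,b_s\in\mathcal H$ and, for $x\in\mathcal A_a$ and $h\in H$, let $\mathcal L_jx(h)=\langle x,\Pi^*(-h)b_j\rangle$, where $\Pi^*(-h)$ is the adjoint of $\Pi(-h)$. Let $G_j=\sum_{k\in H}\mathcal L_ja(k)\,\chi_k\in L^2(\widehat H)$ (so that $\mathcal L_jx(m)=\langle F,\overline{G_j}\chi_m\rangle_{L^2(\widehat H)}$ for $x=\mathcal T_{H,a}F$ and $m\in M$), and assume that $G_j\in L^\infty(\widehat H)$ for $j=1,\dots,s$. Let $\mathbb G(\xi)=\big(G_j(\xi+\mu_k^\perp)\big)_{j=1,\dots,s;\,k=0,\dots,r-1}$, an $s\times r$ matrix, and $\alpha_{\mathbb G}=\operatorname{ess\,inf}_{\xi\in\Omega}\lambda_{\min}[\mathbb G^*(\xi)\mathbb G(\xi)]$, where $\lambda_{\min}$ denotes the smallest eigenvalue. The following statements are equivalent: (a) $\alpha_{\mathbb G}>0$. (b)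 There exist functions $H_1,\dots,H_s\in L^\infty(\widehat H)$ with $\big(H_1(\xi),\dots,H_s(\xi)\big)\,\mathbb G(\xi)=(1,0,\dots,0)$ for a.e. $\xi\in\widehat H$. (c) There exist $c_1,\dots,c_s\in\mathcal A_a$ such that $\{\Pi(m)c_j\}_{m\in M;\,j=1,\dots,s}$ is a frame for $\mathcal A_a$ and $x=\sum_{j=1}^s\sum_{m\in M}\mathcal L_jx(m)\,\Pi(m)c_j$ in $\mathcal H$ for every $x\in\mathcal A_a$. (d) There exists a frame $\{C_{j,m}\}_{m\in M;\,j=1,\dots,s}$ for $\mathcal A_a$ such that $x=\sum_{j=1}^s\sum_{m\in M}\mathcal L_jx(m)\,C_{j,m}$ in $\mathcal H$ for every $x\in\mathcal A_a$. Moreover, whenever $c_1,\dots,c_s$ are as in (c), there are functions $H_1,\dots,H_s\in L^\infty(\widehat H)$ satisfying the identity in (b) such that $c_j=\mathcal T_{H,a}(rH_j)$ for $j=1,\dots,s$. -/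

import Mathlib

open MeasureTheory
open scoped ENNReal Pointwise Matrix InnerProductSpace

noncomputable section

namespace LCASampling

/-- A uniform lattice of a topological abelian group: a discrete subgroup with compact quotient. -/
class IsUniformLattice {G : Type*} [AddCommGroup G] [TopologicalSpace G] (K : AddSubgroup G) :
    Prop where
  discrete : DiscreteTopology K
  cocompact : CompactSpace (G ⧸ K)

instance {G : Type*} [AddCommGroup G] [TopologicalSpace G] (K : AddSubgroup G)
    [IsUniformLattice K] : DiscreteTopology K := IsUniformLattice.discrete

/-! ### The dual group of a lattice -/

section Dual

variable {G : Type*} [AddCommGroup G] [TopologicalSpace G]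

/-- The dual group of `H`: the continuous characters of `H` with the topology of uniform
convergence on compact sets. Its group law is written multiplicatively. -/
abbrev Dual (H : AddSubgroup G) : Type _ := PontryaginDual (Multiplicative H)

instance (H : AddSubgroup G) : MeasurableSpace (Dual H) := borel _

instance (H : AddSubgroup G) : BorelSpace (Dual H) := ⟨rfl⟩

/-- The Haar measure of the compact group `Dual H`, normalized to total mass one. -/
def dualHaar (H : AddSubgroup G) [DiscreteTopology H] : Measure (Dual H) :=
  Measure.haarMeasure ⊤

instance (H : AddSubgroup G) [DiscreteTopology H] : IsProbabilityMeasure (dualHaar H) :=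
  ⟨by simpa [dualHaar] using Measure.haarMeasure_self (K₀ := (⊤ : TopologicalSpace.PositiveCompacts (Dual H)))⟩

/-- The function `χ_h : γ ↦ (h, γ)` on the dual group. -/
def chi (H : AddSubgroup G) (h : H) : C(Dual H, ℂ) where
  toFun γ := (γ (Multiplicative.ofAdd h) : ℂ)
  continuous_toFun :=
    continuous_subtype_val.comp
      (continuous_eval_const (F := Multiplicative H →ₜ* Circle) (Multiplicative.ofAdd h))

/-- `χ_h` as an element of `L²` of the dual group. -/
def chiL2 (H : AddSubgroup G) [DiscreteTopology H] (h : H) : Lp ℂ 2 (dualHaar H) :=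
  ContinuousMap.toLp 2 (dualHaar H) ℂ (chi H h)

/-- An essentially bounded function on the dual group, as an element of `L²`. -/
def linftyToL2 (H : AddSubgroup G) [DiscreteTopology H] (F : Dual H → ℂ)
    (hF : MemLp F ∞ (dualHaar H)) : Lp ℂ 2 (dualHaar H) :=
  (hF.mono_exponent le_top).toLp F

/-- The annihilator of `M` in the dual group of `H`. -/
def annihilator {H M : AddSubgroup G} (hMH : M ≤ H) : Subgroup (Dual H) where
  carrier := {γ | ∀ m : M, γ (Multiplicative.ofAdd ⟨m, hMH m.2⟩) = 1}
  one_mem' := fun _ => rfl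
  mul_mem' := fun {γ γ'} hγ hγ' m => by
    have : (γ * γ') (Multiplicative.ofAdd ⟨m, hMH m.2⟩) =
      γ (Multiplicative.ofAdd ⟨m, hMH m.2⟩) * γ' (Multiplicative.ofAdd ⟨m, hMH m.2⟩) := rfl
    rw [this, hγ m, hγ' m, one_mul]
  inv_mem' := fun {γ} hγ m => by
    have : γ⁻¹ (Multiplicative.ofAdd ⟨m, hMH m.2⟩) =
      (γ (Multiplicative.ofAdd ⟨m, hMH m.2⟩))⁻¹ := rfl
    rw [this, hγ m, inv_one]

/-- For nested uniform lattices `M ≤ H`, the quotient `H / M` is finite. -/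
theorem finite_quotient [IsTopologicalAddGroup G] [T2Space G] {H M : AddSubgroup G}
    [hH : IsUniformLattice H] [hM : IsUniformLattice M] (hMH : M ≤ H) :
    Finite (H ⧸ M.addSubgroupOf H) := by
  have := hM.cocompact
  have := hH.discrete
  have := hM.discrete
  have : IsClosed (M : Set G) := AddSubgroup.isClosed_of_discrete
  let q : G →+ G ⧸ M := QuotientAddGroup.mk' M
  let Q : AddSubgroup (G ⧸ M) := H.map q
  have hdisc : DiscreteTopology Q := by
    obtain ⟨U, hU, hUH⟩ : ∃ U : Set G, IsOpen U ∧ ((↑) : H → G) ⁻¹' U = {0} :=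
      isOpen_induced_iff.mp (isOpen_discrete ({0} : Set H))
    have hqU : IsOpen (q '' U) := QuotientAddGroup.isOpenMap_coe U hU
    refine discreteTopology_of_isOpen_singleton_zero ?_
    refine isOpen_induced_iff.mpr ⟨q '' U, hqU, ?_⟩
    ext ⟨y, hy⟩
    simp only [Set.mem_preimage, Set.mem_singleton_iff]
    constructor
    · rintro ⟨u, hu, huy⟩
      obtain ⟨h, hh, hhy⟩ := hy
      have huM : -u + h ∈ M := QuotientAddGroup.eq.mp (huy.trans hhy.symm)
      have huH : u ∈ H := by
        have := H.sub_mem hh (hMH huM)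
        simpa using this
      have : (⟨u, huH⟩ : H) ∈ ((↑) : H → G) ⁻¹' U := hu
      rw [hUH] at this
      have hu0 : u = 0 := congrArg Subtype.val this
      ext
      simp only [← huy, hu0, map_zero, ZeroMemClass.coe_zero]
    · intro h0
      have hy0 : y = 0 := congrArg Subtype.val h0
      have : (0 : H) ∈ ((↑) : H → G) ⁻¹' U := by rw [hUH]; rfl
      exact ⟨0, this, by rw [hy0, map_zero]⟩
  have hcl : IsClosed (Q : Set (G ⧸ M)) := AddSubgroup.isClosed_of_discrete
  have : CompactSpace Q := isCompact_iff_compactSpace.mp hcl.isCompact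
  have : Finite Q := finite_of_compact_of_discrete
  let f : H →+ Q := (q.comp H.subtype).codRestrict Q (fun h => ⟨h, h.2, rfl⟩)
  refine Finite.of_injective (fun x : H ⧸ M.addSubgroupOf H => f x.out) ?_
  intro x y hxy
  have h1 : q (x.out : G) = q (y.out : G) := congrArg Subtype.val hxy
  have h2 : -(x.out : G) + (y.out : G) ∈ M := QuotientAddGroup.eq.mp h1
  rw [← QuotientAddGroup.out_eq' x, ← QuotientAddGroup.out_eq' y]
  exact QuotientAddGroup.eq.mpr h2

instance finite_annihilator [IsTopologicalAddGroup G] [T2Space G] {H M : AddSubgroup G}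
    [IsUniformLattice H] [IsUniformLattice M] (hMH : M ≤ H) : Finite (annihilator hMH) := by
  have := finite_quotient hMH
  let N := M.addSubgroupOf H
  let n := Nat.card (H ⧸ N)
  have hn : 0 < n := Nat.card_pos
  have hval : ∀ γ ∈ annihilator hMH, ∀ x : H, x ∈ N → γ (Multiplicative.ofAdd x) = 1 :=
    fun γ hγ x hx => hγ ⟨x, hx⟩
  have : Finite {z : ℂ // z ^ n = 1} := by
    refine Finite.of_injective
      (fun z => (⟨z.1, (Polynomial.mem_nthRootsFinset hn (1 : ℂ)).mpr z.2⟩ :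
        {z : ℂ // z ∈ Polynomial.nthRootsFinset n (1 : ℂ)})) ?_
    intro z w h
    exact Subtype.ext (Subtype.mk.inj h)
  refine Finite.of_injective (fun (γ : annihilator hMH) (x : H ⧸ N) =>
    (⟨(γ.1 (Multiplicative.ofAdd x.out) : ℂ), ?_⟩ : {z : ℂ // z ^ n = 1})) ?_
  · have hmem : n • x.out ∈ N := by
      rw [← QuotientAddGroup.eq_zero_iff, QuotientAddGroup.mk_nsmul]
      exact card_nsmul_eq_zero'
    have := hval γ.1 γ.2 _ hmem
    rw [ofAdd_nsmul, map_pow] at this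
    exact_mod_cast congrArg (fun z : Circle => (z : ℂ)) this
  · intro γ γ' h
    ext1
    refine PontryaginDual.ext fun x => ?_
    let y : H := x.toAdd
    let t : H := (QuotientAddGroup.mk y : H ⧸ N).out
    have ht : -t + y ∈ N :=
      QuotientAddGroup.eq.mp (QuotientAddGroup.out_eq' (QuotientAddGroup.mk y : H ⧸ N))
    have key : ∀ δ ∈ annihilator hMH, δ x = δ (Multiplicative.ofAdd t) := fun δ hδ => by
      have hx : x = Multiplicative.ofAdd t * Multiplicative.ofAdd (-t + y) := by
        rw [← ofAdd_add, add_neg_cancel_left]; rfl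
      rw [hx, map_mul, hval δ hδ _ ht, mul_one]
    rw [key _ γ.2, key _ γ'.2]
    have := congrFun h (QuotientAddGroup.mk y)
    exact Circle.ext (Subtype.mk.inj this)

instance [IsTopologicalAddGroup G] [T2Space G] {H M : AddSubgroup G}
    [IsUniformLattice H] [IsUniformLattice M] (hMH : M ≤ H) : Fintype (annihilator hMH) :=
  Fintype.ofFinite _

/-- A Borel section of the quotient of the dual group of `H` by the annihilator of `M`: a
measurable set whose translates by the elements of the annihilator partition the dual group. -/
structure IsSection {H M : AddSubgroup G} (hMH : M ≤ H) (Ω : Set (Dual H)) : Prop where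
  measurableSet : MeasurableSet Ω
  iUnion_eq : ⋃ ν : annihilator hMH, (ν : Dual H) • Ω = Set.univ
  disjoint : Pairwise fun ν ν' : annihilator hMH =>
    Disjoint ((ν : Dual H) • Ω) ((ν' : Dual H) • Ω)

end Dual

/-! ### Frames and Riesz sequences -/

section Frames

variable {E : Type*} [NormedAddCommGroup E] [InnerProductSpace ℂ E]

/-- `u` is a Riesz sequence: a Riesz basis of its closed linear span. -/
def IsRieszSequence {ι : Type*} (u : ι → E) : Prop :=
  ∃ A B : ℝ, 0 < A ∧ 0 < B ∧ ∀ α : ι →₀ ℂ,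
    A * (α.sum fun _ z => ‖z‖ ^ 2) ≤ ‖α.sum fun i z => z • u i‖ ^ 2 ∧
      ‖α.sum fun i z => z • u i‖ ^ 2 ≤ B * (α.sum fun _ z => ‖z‖ ^ 2)

/-- `u` is a frame for the subspace `V`. -/
def IsFrameFor {ι : Type*} (u : ι → E) (V : Submodule ℂ E) : Prop :=
  (∀ i, u i ∈ V) ∧ ∃ A B : ℝ, 0 < A ∧ 0 < B ∧ ∀ x ∈ V,
    Summable (fun i => ‖⟪u i, x⟫_ℂ‖ ^ 2) ∧
      A * ‖x‖ ^ 2 ≤ ∑' i, ‖⟪u i, x⟫_ℂ‖ ^ 2 ∧ ∑' i, ‖⟪u i, x⟫_ℂ‖ ^ 2 ≤ B * ‖x‖ ^ 2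

end Frames

/-! ### The sampling problem -/

section Sampling

variable {G : Type*} [AddCommGroup G] [TopologicalSpace G]
  {E : Type*} [NormedAddCommGroup E] [InnerProductSpace ℂ E]

/-- The bounded operator `Π(g)` of a representation `Π` of the additive group `G` by bounded
invertible operators. -/
def op (ρ : Multiplicative G →* (E ≃L[ℂ] E)) (g : G) : E →L[ℂ] E :=
  (ρ (Multiplicative.ofAdd g) : E →L[ℂ] E)

/-- The subspace `𝒜_a`, the closed linear span of `Π(h) a`, `h ∈ H`. -/
def genSubspace (ρ : Multiplicative G →* (E ≃L[ℂ] E)) (H : AddSubgroup G) (a : E) :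
    Submodule ℂ E :=
  (Submodule.span ℂ (Set.range fun h : H => op ρ h a)).topologicalClosure

/-- The sample `ℒx(g) = ⟨x, Π*(-g) b⟩`, where the inner product of the text, linear in its first
argument, is Mathlib's with the arguments exchanged. -/
def sample [CompleteSpace E] (ρ : Multiplicative G →* (E ≃L[ℂ] E)) (b x : E) (g : G) : ℂ :=
  ⟪ContinuousLinearMap.adjoint (op ρ (-g)) b, x⟫_ℂ

/-- The map `𝒯_{H,a}`, sending `F = ∑ α_h χ_h` in `L²` of the dual group to `∑ α_h Π(h) a`. The
`χ_h` are orthonormal, so `α_h = ⟨F, χ_h⟩`. The series converges unconditionally whenever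
`Π(h) a`, `h ∈ H`, is a Riesz sequence. -/
def synth (ρ : Multiplicative G →* (E ≃L[ℂ] E)) (H : AddSubgroup G) [DiscreteTopology H] (a : E)
    (F : Lp ℂ 2 (dualHaar H)) : E :=
  ∑' h : H, ⟪chiL2 H h, F⟫_ℂ • op ρ h a

/-- The function `∑ ℒa(k) χ_k`, `k ∈ H`, in `L²` of the dual group, attached to `b`. The series
converges unconditionally in `L²` whenever `Π(h) a`, `h ∈ H`, is a Riesz sequence. -/
def sampleFun [CompleteSpace E] (ρ : Multiplicative G →* (E ≃L[ℂ] E)) (H : AddSubgroup G)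
    [DiscreteTopology H] (a b : E) : Lp ℂ 2 (dualHaar H) :=
  ∑' k : H, sample ρ b a k • chiL2 H k

end Sampling

/-! ### The matrix of translates and its constant -/

section Matrices

open Classical in
/-- The smallest eigenvalue of `Aᴴ A`. -/
def lambdaMin {m n : Type*} [Fintype m] [Fintype n] (A : Matrix m n ℂ) : ℝ :=
  ⨅ i, (Matrix.isHermitian_conjTranspose_mul_self A).eigenvalues i

variable {G : Type*} [AddCommGroup G] [TopologicalSpace G]

/-- The matrix with entries `Γ_j (ξ + ν)`, with rows indexed by `j = 1, …, s` and columns by the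
elements `ν` of the annihilator of `M`. -/
def translateMatrix {H M : AddSubgroup G} (hMH : M ≤ H) {s : ℕ} (Γ : Fin s → Dual H → ℂ)
    (ξ : Dual H) : Matrix (Fin s) (annihilator hMH) ℂ :=
  Matrix.of fun j ν => Γ j (ξ * ν)

/-- The essential infimum over `Ω` of the smallest eigenvalue (a nonnegative number) of
`𝔾(ξ)ᴴ 𝔾(ξ)`. -/
def alphaConst [IsTopologicalAddGroup G] [T2Space G] {H M : AddSubgroup G} [IsUniformLattice H]
    [IsUniformLattice M] (hMH : M ≤ H) {s : ℕ} (Γ : Fin s → Dual H → ℂ) (Ω : Set (Dual H)) :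
    ℝ≥0∞ :=
  essInf (fun ξ => ENNReal.ofReal (lambdaMin (translateMatrix hMH Γ ξ)))
    ((dualHaar H).restrict Ω)

open Classical in
/-- The row vector `(1, 0, …, 0)`, the first column being that of the neutral element. -/
def firstRow {H M : AddSubgroup G} (hMH : M ≤ H) : annihilator hMH → ℂ :=
  Pi.single 1 1

end Matrices

end LCASampling

end

/-! The Riesz property makes $T=$ `synthOp` an isomorphism from $L^2(\widehat H)$ onto $\mathcal
A_a$ that turns multiplication by $\chi_h$ into $\Pi(h)$ (`synthOp_mulOp_chi`). The sample $\mathcal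
L_j(Tf)(k)$ is the $k$-th Fourier coefficient of $G_jf$ (`sample_synthOp`). Keeping only $k\in M$
amounts to applying $P=$ `perOp`, the average over $M^\perp$, so that $\sum_m|\mathcal
L_j(Tf)(m)|^2=\|P(G_jf)\|^2$. The sampling series with generators $T\Phi_j$ sums to
$T\big(\sum_j\Phi_jP(G_jf)\big)$. With $\Phi_j=rH_j$ the function in brackets is pointwise the row
$(H_j)_j\,\mathbb G(\xi)$ paired with $(f(\xi\nu))_\nu$, so reconstruction is exactly the identity
in (b).

(a) ⇒ (b): the row of $(\mathbb G^*\mathbb G)^{-1}\mathbb G^*$ at the neutral element is measurable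
and bounded by $\delta^{-1/2}$ when $\delta$ bounds $\mathbb G^*\mathbb G$ from below
(`pinvRow_spec`).

(b) ⇒ (c) and (d) ⇒ (a) share one Cauchy–Schwarz estimate: if $x=\sum l_pC_p$ then
$\|x\|^4\le\sum|l_p|^2\sum|\langle C_p,x\rangle|^2$. An upper bound on either sum gives a lower
bound on the other. For (a), the lower bound on the samples is tested on step functions over
$\Omega$, which localizes it to a bound for $\mathbb G(\xi)$.

The last claim writes $c_j=Tf_j$. The Bessel bound forces $f_j$ to be essentially bounded, and
reconstruction of indicators of translates of $\Omega$ gives the matrix identity for $r^{-1}f_j$. -/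

noncomputable section

namespace LCASampling

open scoped ComplexConjugate

/-! ### Characters of a discrete group as a Hilbert basis of $L^2$ of its dual. -/

section Characters

variable {G : Type*} [AddCommGroup G] [TopologicalSpace G] {H : AddSubgroup G}

lemma chi_apply (h : H) (γ : Dual H) : chi H h γ = (γ (Multiplicative.ofAdd h) : ℂ) := rfl

@[simp] lemma chi_zero (γ : Dual H) : chi H 0 γ = 1 := by
  rw [chi_apply, ofAdd_zero, map_one, Circle.coe_one]

lemma chi_add (h k : H) (γ : Dual H) : chi H (h + k) γ = chi H h γ * chi H k γ := by
  rw [chi_apply, ofAdd_add, map_mul, Circle.coe_mul]; rfl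

lemma chi_neg (h : H) (γ : Dual H) : chi H (-h) γ = conj (chi H h γ) := by
  rw [chi_apply, ofAdd_neg, map_inv, Circle.coe_inv_eq_conj]; rfl

lemma chi_mul_right (h : H) (γ ν : Dual H) : chi H h (γ * ν) = chi H h γ * chi H h ν := by
  simp only [chi_apply]
  rw [show (γ * ν) (Multiplicative.ofAdd h) =
    γ (Multiplicative.ofAdd h) * ν (Multiplicative.ofAdd h) from rfl, Circle.coe_mul]

@[simp] lemma norm_chi (h : H) (γ : Dual H) : ‖chi H h γ‖ = 1 := Circle.norm_coe _

lemma chi_of_mem_annihilator {M : AddSubgroup G} {hMH : M ≤ H} {ν : Dual H}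
    (hν : ν ∈ annihilator hMH) {h : H} (hh : (h : G) ∈ M) : chi H h ν = 1 := by
  rw [chi_apply, show ν (Multiplicative.ofAdd h) = 1 from hν ⟨h, hh⟩, Circle.coe_one]

/-- Characters trivial on `M` separate the points of `H` from `M`. -/
lemma exists_mem_annihilator_chi_ne_one [DiscreteTopology H] {M : AddSubgroup G} (hMH : M ≤ H)
    {h : H} (hh : (h : G) ∉ M) : ∃ ν ∈ annihilator hMH, chi H h ν ≠ 1 := by
  have hne : (QuotientAddGroup.mk h : H ⧸ M.addSubgroupOf H) ≠ 0 := by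
    rwa [Ne, QuotientAddGroup.eq_zero_iff, AddSubgroup.mem_addSubgroupOf]
  -- Characters with values in $\mathbb Q/\mathbb Z$ separate the points of any abelian group.
  -- Composing with the embedding $\mathbb Q/\mathbb Z\to\mathbb R/\mathbb Z$ gives a circle-valued
  -- one, and continuity is free because $H$ is discrete.
  obtain ⟨c, hc⟩ := CharacterModule.exists_character_apply_ne_zero_of_ne_zero hne
  let φ : AddCircle (1 : ℚ) →+ AddCircle (1 : ℝ) :=
    QuotientAddGroup.map _ _ (Rat.castHom ℝ : ℚ →+ ℝ) (by
      intro x hx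
      obtain ⟨n, rfl⟩ := AddSubgroup.mem_zmultiples_iff.mp hx
      exact AddSubgroup.mem_zmultiples_iff.mpr ⟨n, by simp⟩)
  have hφ : ∀ x, φ x = 0 → x = 0 := by
    intro x
    induction x using QuotientAddGroup.induction_on with
    | H z =>
      intro hz
      have hz' : ((z : ℝ) : AddCircle (1 : ℝ)) = 0 := hz
      obtain ⟨n, hn⟩ := AddSubgroup.mem_zmultiples_iff.mp
        ((QuotientAddGroup.eq_zero_iff _).mp hz')
      refine (QuotientAddGroup.eq_zero_iff _).mpr (AddSubgroup.mem_zmultiples_iff.mpr ⟨n, ?_⟩)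
      have : ((n : ℚ) : ℝ) = (z : ℝ) := by simpa using hn
      simpa using (Rat.cast_injective this)
  let ψ : Multiplicative H →* Circle :=
    { toFun := fun x => AddCircle.toCircle (φ (c (QuotientAddGroup.mk x.toAdd)))
      map_one' := by
        rw [toAdd_one, QuotientAddGroup.mk_zero, map_zero, map_zero, AddCircle.toCircle_zero]
      map_mul' := fun x y => by
        rw [toAdd_mul, QuotientAddGroup.mk_add, map_add, map_add, AddCircle.toCircle_add] }
  let ν : Dual H := (⟨ψ, continuous_of_discreteTopology⟩ : Multiplicative H →ₜ* Circle)
  have hν : ∀ k : H, ν (Multiplicative.ofAdd k) =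
    AddCircle.toCircle (φ (c (QuotientAddGroup.mk k))) := fun k => rfl
  refine ⟨ν, fun m => ?_, fun h1 => hc ?_⟩
  · rw [hν, (QuotientAddGroup.eq_zero_iff _).mpr, map_zero, map_zero, AddCircle.toCircle_zero]
    exact AddSubgroup.mem_addSubgroupOf.mpr m.2
  · rw [chi_apply, hν] at h1
    refine hφ _ (AddCircle.injective_toCircle one_ne_zero ?_)
    rw [AddCircle.toCircle_zero]
    exact Circle.ext (by simpa using h1)

variable [DiscreteTopology H]

lemma chiL2_coeFn (h : H) : chiL2 H h =ᵐ[dualHaar H] chi H h :=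
  ContinuousMap.coeFn_toLp _ _

instance : (dualHaar H).IsMulLeftInvariant := by unfold dualHaar; infer_instance

instance : (dualHaar H).WeaklyRegular := by unfold dualHaar; infer_instance

/-- Translation by a $\nu$ with $\chi_h(\nu)\ne1$ preserves the integral and also multiplies it by
$\chi_h(\nu)$. Such a $\nu$ comes from the separation lemma with $M$ trivial. -/
lemma integral_chi {h : H} (hh : h ≠ 0) : ∫ γ, chi H h γ ∂(dualHaar H) = 0 := by
  obtain ⟨ν, -, hν⟩ := exists_mem_annihilator_chi_ne_one (bot_le : (⊥ : AddSubgroup G) ≤ H)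
    (h := h) (by simpa using hh)
  have := integral_mul_left_eq_self (μ := dualHaar H) (fun γ => chi H h γ) ν
  simp only [chi_mul_right, integral_const_mul] at this
  have h2 : (chi H h ν - 1) * ∫ γ, chi H h γ ∂(dualHaar H) = 0 := by
    rw [sub_mul, this, one_mul, sub_self]
  exact (mul_eq_zero.mp h2).resolve_left (sub_ne_zero.mpr hν)

lemma orthonormal_chiL2 : Orthonormal ℂ (chiL2 H) := by
  classical
  rw [orthonormal_iff_ite]
  intro i j
  unfold chiL2
  rw [ContinuousMap.inner_toLp (dualHaar H) (chi H i) (chi H j)]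
  simp_rw [← chi_neg, ← chi_add]
  split_ifs with hij
  · simp [hij]
  · exact integral_chi (fun h0 => hij (sub_eq_zero.mp (by rw [sub_eq_add_neg, h0])).symm)

variable (H) in
/-- The star subalgebra of the continuous functions on the dual group spanned by the characters. -/
def chiSubalgebra : StarSubalgebra ℂ C(Dual H, ℂ) where
  toSubalgebra := Algebra.adjoin ℂ (Set.range (chi H))
  star_mem' := by
    change Algebra.adjoin ℂ (Set.range (chi H)) ≤ star (Algebra.adjoin ℂ (Set.range (chi H)))
    refine Algebra.adjoin_le ?_
    rintro - ⟨h, rfl⟩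
    exact Algebra.subset_adjoin ⟨-h, ContinuousMap.ext fun γ => chi_neg h γ⟩

lemma chiSubalgebra_coe :
    Subalgebra.toSubmodule (chiSubalgebra H).toSubalgebra =
      Submodule.span ℂ (Set.range (chi H)) := by
  apply Algebra.adjoin_eq_span_of_subset
  refine Set.Subset.trans ?_ Submodule.subset_span
  intro x hx
  refine Submonoid.closure_induction (fun _ => id) ⟨0, ?_⟩ ?_ hx
  · ext1 z; exact chi_zero z
  · rintro - - - - ⟨m, rfl⟩ ⟨n, rfl⟩
    exact ⟨m + n, ContinuousMap.ext fun γ => chi_add m n γ⟩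

/-- Stone–Weierstrass: points of the dual group are functions on $H$, so distinct ones are separated
by some $\chi_h$. -/
lemma span_chi_closure_eq_top :
    (Submodule.span ℂ (Set.range (chi H))).topologicalClosure = ⊤ := by
  have hsep : (chiSubalgebra H).SeparatesPoints := by
    intro x y hxy
    obtain ⟨h, hh⟩ : ∃ h : Multiplicative H, x h ≠ y h := by
      by_contra! hcon
      exact hxy (PontryaginDual.ext hcon)
    exact ⟨_, ⟨chi H h.toAdd, Algebra.subset_adjoin ⟨h.toAdd, rfl⟩, rfl⟩,
      fun he => hh (Circle.ext he)⟩
  rw [← chiSubalgebra_coe]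
  exact congr_arg (Subalgebra.toSubmodule <| StarSubalgebra.toSubalgebra ·)
    (ContinuousMap.starSubalgebra_topologicalClosure_eq_top_of_separatesPoints _ hsep)

lemma span_chiL2_closure_eq_top :
    (Submodule.span ℂ (Set.range (chiL2 H))).topologicalClosure = ⊤ := by
  convert! (ContinuousMap.toLp_denseRange ℂ (dualHaar H) ℂ
    (p := 2) (by simp)).topologicalClosure_map_submodule (span_chi_closure_eq_top (H := H))
  rw [Submodule.map_span, ← Set.range_comp]
  rfl

variable (H) in
/-- The orthonormal basis of characters. -/
def chiBasis : HilbertBasis H ℂ (Lp ℂ 2 (dualHaar H)) :=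
  HilbertBasis.mk orthonormal_chiL2 span_chiL2_closure_eq_top.ge

@[simp] lemma coe_chiBasis : ⇑(chiBasis H) = chiL2 H := HilbertBasis.coe_mk _ _

lemma hasSum_chiL2 (F : Lp ℂ 2 (dualHaar H)) :
    HasSum (fun h => ⟪chiL2 H h, F⟫_ℂ • chiL2 H h) F := by
  simpa [HilbertBasis.repr_apply_apply] using (chiBasis H).hasSum_repr F

lemma hasSum_norm_inner_chiL2 (F : Lp ℂ 2 (dualHaar H)) :
    HasSum (fun h => ‖⟪chiL2 H h, F⟫_ℂ‖ ^ 2) (‖F‖ ^ 2) := by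
  have h1 := (chiBasis H).hasSum_inner_mul_inner F F
  rw [inner_self_eq_norm_sq_to_K] at h1
  have h2 := Complex.hasSum_re h1
  simp only [coe_chiBasis] at h2
  convert! h2 using 1
  · ext h
    rw [← inner_conj_symm F, Complex.conj_mul', ← Complex.ofReal_pow, Complex.ofReal_re]
  · norm_cast

lemma clm_ext_chiL2 {E : Type*} [NormedAddCommGroup E] [NormedSpace ℂ E]
    {S T : Lp ℂ 2 (dualHaar H) →L[ℂ] E} (h : ∀ k, S (chiL2 H k) = T (chiL2 H k)) : S = T := by
  refine ContinuousLinearMap.ext_on (s := Set.range (chiL2 H)) ?_ ?_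
  · exact (Submodule.dense_iff_topologicalClosure_eq_top).mpr span_chiL2_closure_eq_top
  · rintro _ ⟨k, rfl⟩
    exact h k

end Characters

/-! ### Multiplication and translation operators on $L^2$ of the dual group. -/

section Operators

variable {G : Type*} [AddCommGroup G] [TopologicalSpace G] {H : AddSubgroup G}
  [DiscreteTopology H]

/-- Multiplication by an essentially bounded function. -/
def mulOp (g : Dual H → ℂ) (hg : MemLp g ∞ (dualHaar H)) :
    Lp ℂ 2 (dualHaar H) →L[ℂ] Lp ℂ 2 (dualHaar H) :=
  (ContinuousLinearMap.mul ℂ ℂ).holderL (dualHaar H) ∞ 2 2 (hg.toLp g)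

lemma mulOp_coeFn {g : Dual H → ℂ} (hg : MemLp g ∞ (dualHaar H)) (F : Lp ℂ 2 (dualHaar H)) :
    mulOp g hg F =ᵐ[dualHaar H] fun ξ => g ξ * F ξ := by
  filter_upwards [(ContinuousLinearMap.mul ℂ ℂ).coeFn_holder (r := 2) (hg.toLp g) F,
    hg.coeFn_toLp] with ξ h1 h2
  rw [← h2]
  exact h1

/-- Used with $g'$ or $g$ a character, to trade a modulated bounded function for a multiplication
operator applied to $\chi_h$. -/
lemma mulOp_linftyToL2_comm {g g' : Dual H → ℂ} (hg : MemLp g ∞ (dualHaar H))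
    (hg' : MemLp g' ∞ (dualHaar H)) :
    mulOp g hg (linftyToL2 H g' hg') = mulOp g' hg' (linftyToL2 H g hg) := by
  refine Lp.ext ?_
  filter_upwards [mulOp_coeFn hg (linftyToL2 H g' hg'), mulOp_coeFn hg' (linftyToL2 H g hg),
    (hg.mono_exponent (le_top : 2 ≤ ∞)).coeFn_toLp,
    (hg'.mono_exponent (le_top : 2 ≤ ∞)).coeFn_toLp] with ξ h1 h2 h3 h4
  rw [h1, h2, linftyToL2, linftyToL2, h3, h4]
  ring

/-- The conjugate is a separate function $g'$ so that $\chi_{-h}$ can stand for $\overline{\chi_h}$.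
-/
lemma inner_mulOp_left {g g' : Dual H → ℂ} (hg : MemLp g ∞ (dualHaar H))
    (hg' : MemLp g' ∞ (dualHaar H)) (hgg' : ∀ ξ, g' ξ = conj (g ξ)) (F F' : Lp ℂ 2 (dualHaar H)) :
    ⟪mulOp g hg F, F'⟫_ℂ = ⟪F, mulOp g' hg' F'⟫_ℂ := by
  rw [L2.inner_def, L2.inner_def]
  refine integral_congr_ae ?_
  filter_upwards [mulOp_coeFn hg F, mulOp_coeFn hg' F'] with ξ h1 h2
  rw [h1, h2, hgg', RCLike.inner_apply, RCLike.inner_apply, map_mul]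
  ring

lemma memLp_conj {g : Dual H → ℂ} {p : ℝ≥0∞} (hg : MemLp g p (dualHaar H)) :
    MemLp (fun ξ => conj (g ξ)) p (dualHaar H) := hg.star

lemma memLp_chi (h : H) : MemLp (chi H h) ∞ (dualHaar H) :=
  memLp_top_of_bound (chi H h).continuous.aestronglyMeasurable 1
    (Filter.Eventually.of_forall fun γ => (norm_chi h γ).le)

lemma mulOp_chi_chiL2 (h k : H) : mulOp (chi H h) (memLp_chi h) (chiL2 H k) = chiL2 H (h + k) := by
  refine Lp.ext ?_
  filter_upwards [mulOp_coeFn (memLp_chi h) (chiL2 H k), chiL2_coeFn k, chiL2_coeFn (h + k)]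
    with ξ h1 h2 h3
  rw [h1, h2, h3, chi_add]

lemma linftyToL2_chi (h : H) : linftyToL2 H (chi H h) (memLp_chi h) = chiL2 H h := by
  refine Lp.ext ?_
  filter_upwards [((memLp_chi h).mono_exponent (le_top : 2 ≤ ∞)).coeFn_toLp, chiL2_coeFn h]
    with ξ h1 h2
  rw [linftyToL2, h1, h2]

lemma inner_mulOp_chi_left (h : H) (F F' : Lp ℂ 2 (dualHaar H)) :
    ⟪mulOp (chi H h) (memLp_chi h) F, F'⟫_ℂ = ⟪F, mulOp (chi H (-h)) (memLp_chi (-h)) F'⟫_ℂ :=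
  inner_mulOp_left _ _ (chi_neg h) _ _

lemma measurePreserving_mul_right' (ν : Dual H) :
    MeasurePreserving (fun ξ : Dual H => ξ * ν) (dualHaar H) (dualHaar H) := by
  have := measurePreserving_mul_left (dualHaar H) ν
  simpa only [mul_comm] using this

/-- Translation by `ν`. -/
def translOp (ν : Dual H) : Lp ℂ 2 (dualHaar H) →L[ℂ] Lp ℂ 2 (dualHaar H) :=
  (Lp.compMeasurePreservingₗᵢ ℂ _ (measurePreserving_mul_right' ν)).toContinuousLinearMap

lemma translOp_coeFn (ν : Dual H) (F : Lp ℂ 2 (dualHaar H)) :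
    translOp ν F =ᵐ[dualHaar H] fun ξ => F (ξ * ν) :=
  Lp.coeFn_compMeasurePreserving F (measurePreserving_mul_right' ν)

lemma translOp_chiL2 (ν : Dual H) (h : H) : translOp ν (chiL2 H h) = chi H h ν • chiL2 H h := by
  refine Lp.ext ?_
  filter_upwards [translOp_coeFn ν (chiL2 H h), chiL2_coeFn h, Lp.coeFn_smul (chi H h ν) (chiL2 H h),
    (measurePreserving_mul_right' ν).quasiMeasurePreserving.ae (chiL2_coeFn h)] with ξ h1 h2 h3 h4
  rw [h1, h3, Pi.smul_apply, h4, h2, chi_mul_right, smul_eq_mul, mul_comm]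

end Operators

/-! ### Averaging over the annihilator selects the Fourier coefficients indexed by $M$. -/

section Periodization

variable {G : Type*} [AddCommGroup G] [TopologicalSpace G] [IsTopologicalAddGroup G] [T2Space G]
  {H M : AddSubgroup G} [IsUniformLattice H] [IsUniformLattice M] (hMH : M ≤ H)

/-- The average of the translates by the elements of the annihilator. -/
def perOp : Lp ℂ 2 (dualHaar H) →L[ℂ] Lp ℂ 2 (dualHaar H) :=
  (Nat.card (annihilator hMH) : ℂ)⁻¹ • ∑ ν : annihilator hMH, translOp (ν : Dual H)

lemma card_annihilator_ne_zero : (Nat.card (annihilator hMH) : ℂ) ≠ 0 :=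
  Nat.cast_ne_zero.mpr Nat.card_pos.ne'

lemma perOp_coeFn (F : Lp ℂ 2 (dualHaar H)) :
    perOp hMH F =ᵐ[dualHaar H]
      fun ξ => (Nat.card (annihilator hMH) : ℂ)⁻¹ * ∑ ν : annihilator hMH, F (ξ * ν) := by
  have h1 : ∀ᵐ ξ ∂(dualHaar H), ∀ ν : annihilator hMH, translOp (ν : Dual H) F ξ = F (ξ * ν) :=
    ae_all_iff.mpr fun ν => translOp_coeFn (ν : Dual H) F
  have h2 : perOp hMH F = (Nat.card (annihilator hMH) : ℂ)⁻¹ •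
      ∑ ν : annihilator hMH, translOp (ν : Dual H) F := by
    simp [perOp]
  rw [h2]
  filter_upwards [h1, Lp.coeFn_smul (Nat.card (annihilator hMH) : ℂ)⁻¹
    (∑ ν : annihilator hMH, translOp (ν : Dual H) F),
    Lp.coeFn_finsetSum Finset.univ (fun ν : annihilator hMH => translOp (ν : Dual H) F)] with ξ h3 h4 h5
  rw [h4, Pi.smul_apply, h5, Finset.sum_apply, smul_eq_mul]
  simp only [h3]

lemma perOp_chiL2_of_mem {h : H} (hh : (h : G) ∈ M) : perOp hMH (chiL2 H h) = chiL2 H h := by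
  simp only [perOp, _root_.smul_apply, _root_.sum_apply, translOp_chiL2]
  rw [Finset.sum_congr rfl fun ν _ => by rw [chi_of_mem_annihilator ν.2 hh, one_smul]]
  rw [Finset.sum_const, Finset.card_univ, ← Nat.card_eq_fintype_card, ← Nat.cast_smul_eq_nsmul ℂ,
    smul_smul, inv_mul_cancel₀ (card_annihilator_ne_zero hMH), one_smul]

/-- Orthogonality over a finite group: some $\nu_0\in M^\perp$ has $\chi_h(\nu_0)\ne1$, and
reindexing by $\nu_0$ multiplies $\sum_\nu\chi_h(\nu)$ by $\chi_h(\nu_0)$. -/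
lemma perOp_chiL2_of_notMem {h : H} (hh : (h : G) ∉ M) : perOp hMH (chiL2 H h) = 0 := by
  simp only [perOp, _root_.smul_apply, _root_.sum_apply, translOp_chiL2]
  rw [← Finset.sum_smul]
  obtain ⟨ν₀, hν₀, hne⟩ := exists_mem_annihilator_chi_ne_one hMH hh
  have h1 : ∑ ν : annihilator hMH, chi H h (ν : Dual H) =
      chi H h ν₀ * ∑ ν : annihilator hMH, chi H h (ν : Dual H) := by
    rw [Finset.mul_sum, ← Equiv.sum_comp (Equiv.mulRight (⟨ν₀, hν₀⟩ : annihilator hMH))]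
    refine Finset.sum_congr rfl fun ν _ => ?_
    rw [Equiv.coe_mulRight, Subgroup.coe_mul, chi_mul_right, mul_comm]
  have h2 : (chi H h ν₀ - 1) * ∑ ν : annihilator hMH, chi H h (ν : Dual H) = 0 := by
    rw [sub_mul, one_mul, ← h1, sub_self]
  rw [(mul_eq_zero.mp h2).resolve_left (sub_ne_zero.mpr hne), zero_smul, smul_zero]

lemma hasSum_perOp (F : Lp ℂ 2 (dualHaar H)) :
    HasSum (fun m : M => ⟪chiL2 H ⟨m, hMH m.2⟩, F⟫_ℂ • chiL2 H ⟨m, hMH m.2⟩) (perOp hMH F) := by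
  have h1 := (hasSum_chiL2 F).mapL (perOp hMH)
  have hinj : Function.Injective (fun m : M => (⟨m, hMH m.2⟩ : H)) := fun m m' h =>
    Subtype.ext (congrArg (fun k : H => (k : G)) h)
  rw [← hinj.hasSum_iff] at h1
  · convert! h1 using 2 with m
    rw [Function.comp_apply, map_smul, perOp_chiL2_of_mem hMH m.2]
  · intro h hh
    rw [map_smul, perOp_chiL2_of_notMem hMH, smul_zero]
    exact fun hM => hh ⟨⟨h, hM⟩, rfl⟩

lemma hasSum_norm_inner_perOp (F : Lp ℂ 2 (dualHaar H)) :
    HasSum (fun m : M => ‖⟪chiL2 H ⟨m, hMH m.2⟩, F⟫_ℂ‖ ^ 2) (‖perOp hMH F‖ ^ 2) := by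
  have hinj : Function.Injective (fun m : M => (⟨m, hMH m.2⟩ : H)) := fun m m' h =>
    Subtype.ext (congrArg (fun k : H => (k : G)) h)
  have horth : Orthonormal ℂ (fun m : M => chiL2 H ⟨m, hMH m.2⟩) :=
    orthonormal_chiL2.comp _ hinj
  have h1 := (hasSum_perOp hMH F).mapL (innerSL ℂ (perOp hMH F))
  have h3 : ∀ m : M, ⟪chiL2 H ⟨m, hMH m.2⟩, perOp hMH F⟫_ℂ = ⟪chiL2 H ⟨m, hMH m.2⟩, F⟫_ℂ := by
    classical
    intro m
    have h4 := (hasSum_perOp hMH F).mapL (innerSL ℂ (chiL2 H ⟨m, hMH m.2⟩))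
    simp only [innerSL_apply_apply, inner_smul_right, orthonormal_iff_ite.mp horth] at h4
    refine h4.unique ?_
    convert! hasSum_ite_eq m ⟪chiL2 H ⟨m, hMH m.2⟩, F⟫_ℂ using 2 with m'
    by_cases hm : m = m'
    · subst hm; rw [if_pos rfl, if_pos rfl, mul_one]
    · rw [if_neg hm, if_neg (Ne.symm hm), mul_zero]
  have h2 := Complex.hasSum_re h1
  simp only [innerSL_apply_apply, inner_smul_right] at h2
  convert! h2 using 1
  · ext m
    rw [← inner_conj_symm (perOp hMH F), h3, Complex.mul_conj', ← Complex.ofReal_pow,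
      Complex.ofReal_re]
  · rw [inner_self_eq_norm_sq_to_K]; norm_cast

end Periodization

/-! ### Integration and step functions over a section. -/

section Sections

variable {G : Type*} [AddCommGroup G] [TopologicalSpace G] [IsTopologicalAddGroup G] [T2Space G]
  {H M : AddSubgroup G} [IsUniformLattice H] [IsUniformLattice M] {hMH : M ≤ H}
  {Ω : Set (Dual H)}

omit [IsTopologicalAddGroup G] [T2Space G] in
lemma enorm_sq_eq_lintegral (F : Lp ℂ 2 (dualHaar H)) :
    ‖F‖ₑ ^ 2 = ∫⁻ ξ, ‖F ξ‖ₑ ^ 2 ∂(dualHaar H) := by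
  have := eLpNorm_nnreal_pow_eq_lintegral (f := F) (μ := dualHaar H) (p := 2) two_ne_zero
  rw [Lp.enorm_def]
  simpa using this

omit [IsTopologicalAddGroup G] [T2Space G] [IsUniformLattice M] in
lemma IsSection.isFundamentalDomain (hΩ : IsSection hMH Ω) :
    IsFundamentalDomain (annihilator hMH) Ω (dualHaar H) where
  nullMeasurableSet := hΩ.measurableSet.nullMeasurableSet
  ae_covers := Filter.Eventually.of_forall fun ξ => by
    have h : ξ ∈ ⋃ ν : annihilator hMH, (ν : Dual H) • Ω := hΩ.iUnion_eq ▸ Set.mem_univ ξ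
    obtain ⟨ν, hν⟩ := Set.mem_iUnion.mp h
    exact ⟨ν⁻¹, Set.mem_smul_set_iff_inv_smul_mem.mp hν⟩
  aedisjoint := fun ν ν' h => (hΩ.disjoint h).aedisjoint

lemma IsSection.lintegral_eq_sum (hΩ : IsSection hMH Ω) (f : Dual H → ℝ≥0∞) :
    ∫⁻ ξ, f ξ ∂(dualHaar H) =
      ∑ ν : annihilator hMH, ∫⁻ ξ in Ω, f (ξ * ν) ∂(dualHaar H) := by
  rw [hΩ.isFundamentalDomain.lintegral_eq_tsum'', tsum_fintype]
  refine Finset.sum_congr rfl fun ν _ => lintegral_congr fun ξ => ?_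
  rw [mul_comm]
  rfl

variable (hMH) in
lemma ae_translates {p : Dual H → Prop} (hp : ∀ᵐ ξ ∂(dualHaar H), p ξ) :
    ∀ᵐ ξ ∂(dualHaar H), ∀ ν : annihilator hMH, p (ξ * ν) :=
  ae_all_iff.mpr fun ν =>
    (measurePreserving_mul_right' (ν : Dual H)).quasiMeasurePreserving.ae hp

/-- Every point is $\xi\nu$ with $\xi\in\Omega$, and the finitely many translations preserve null
sets. -/
lemma IsSection.ae_of_forall (hΩ : IsSection hMH Ω) {p : Dual H → Prop}
    (hp : ∀ᵐ ξ ∂(dualHaar H).restrict Ω, ∀ ν : annihilator hMH, p (ξ * ν)) :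
    ∀ᵐ ξ ∂(dualHaar H), p ξ := by
  have h1 := (ae_restrict_iff' hΩ.measurableSet).mp hp
  filter_upwards [ae_translates hMH h1] with ξ hξ
  have h : ξ ∈ ⋃ ν : annihilator hMH, (ν : Dual H) • Ω := hΩ.iUnion_eq ▸ Set.mem_univ ξ
  obtain ⟨ν, hν⟩ := Set.mem_iUnion.mp h
  have h2 : ξ * (ν⁻¹ : annihilator hMH) ∈ Ω := by
    rw [mul_comm]
    exact Set.mem_smul_set_iff_inv_smul_mem.mp hν
  simpa using hξ ν⁻¹ h2 ν

/-- The function equal to `v ν` on the translate of `A` by `ν`. -/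
def stepFun (v : annihilator hMH → ℂ) (A : Set (Dual H)) (ξ : Dual H) : ℂ :=
  ∑ ν : annihilator hMH, ((ν : Dual H) • A).indicator (fun _ => v ν) ξ

lemma IsSection.stepFun_mul (hΩ : IsSection hMH Ω) (v : annihilator hMH → ℂ) {A : Set (Dual H)}
    (hA : A ⊆ Ω) {ξ : Dual H} (hξ : ξ ∈ Ω) (ν : annihilator hMH) :
    stepFun v A (ξ * ν) = A.indicator (fun _ => v ν) ξ := by
  unfold stepFun
  rw [Finset.sum_eq_single ν]
  · by_cases h : ξ ∈ A
    · rw [Set.indicator_of_mem h, Set.indicator_of_mem]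
      exact Set.mem_smul_set.mpr ⟨ξ, h, mul_comm _ _⟩
    · rw [Set.indicator_of_notMem h, Set.indicator_of_notMem]
      rintro ⟨ζ, hζ, hζξ⟩
      rw [mul_comm] at hζξ
      exact h (mul_left_cancel (a := (ν : Dual H)) hζξ ▸ hζ)
  · intro ν' _ hne
    refine Set.indicator_of_notMem (fun hmem => ?_) _
    refine Set.disjoint_left.mp (hΩ.disjoint hne) (Set.smul_set_mono hA hmem) ?_
    exact Set.mem_smul_set.mpr ⟨ξ, hξ, mul_comm _ _⟩
  · simp

lemma memLp_stepFun (v : annihilator hMH → ℂ) {A : Set (Dual H)} (hA : MeasurableSet A) :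
    MemLp (stepFun v A) ∞ (dualHaar H) :=
  memLp_finsetSum _ fun ν _ => (memLp_const (v ν)).indicator (hA.const_smul _)

lemma IsSection.enorm_sq_stepFun (hΩ : IsSection hMH Ω) (v : annihilator hMH → ℂ)
    {A : Set (Dual H)} (hA : MeasurableSet A) (hAΩ : A ⊆ Ω) :
    ‖linftyToL2 H (stepFun v A) (memLp_stepFun v hA)‖ₑ ^ 2 =
      ∫⁻ _ in A, ∑ ν, ‖v ν‖ₑ ^ 2 ∂(dualHaar H) := by
  rw [enorm_sq_eq_lintegral]
  have h1 : ∫⁻ ξ, ‖linftyToL2 H (stepFun v A) (memLp_stepFun v hA) ξ‖ₑ ^ 2 ∂(dualHaar H) =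
      ∫⁻ ξ, ‖stepFun v A ξ‖ₑ ^ 2 ∂(dualHaar H) := by
    refine lintegral_congr_ae ?_
    filter_upwards [((memLp_stepFun v hA).mono_exponent (le_top : 2 ≤ ∞)).coeFn_toLp] with ξ hξ
    rw [linftyToL2, hξ]
  rw [h1, hΩ.lintegral_eq_sum, lintegral_const, Finset.sum_mul]
  refine Finset.sum_congr rfl fun ν _ => ?_
  rw [← lintegral_const, ← Set.inter_eq_self_of_subset_left hAΩ, ← Measure.restrict_restrict hA,
    ← lintegral_indicator hA]
  refine setLIntegral_congr_fun hΩ.measurableSet fun ξ hξ => ?_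
  simp only [Set.inter_eq_self_of_subset_left hAΩ]
  rw [hΩ.stepFun_mul v hAΩ hξ]
  by_cases h : ξ ∈ A <;> simp [h]

/-- The average is $M^\perp$-invariant, and on $\Omega$ it equals $r^{-1}\mathbf 1_A(\xi)\sum_\nu
g(\xi\nu)v_\nu$. Each of the $r$ translates of $\Omega$ thus contributes $r^{-2}$ times the integral
on the right. Extended nonnegative values dispense with integrability conditions. -/
lemma IsSection.enorm_sq_perOp (hΩ : IsSection hMH Ω) (v : annihilator hMH → ℂ)
    {A : Set (Dual H)} (hA : MeasurableSet A) (hAΩ : A ⊆ Ω) {g : Dual H → ℂ}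
    {F : Lp ℂ 2 (dualHaar H)} (hF : ∀ᵐ ξ ∂(dualHaar H), F ξ = g ξ * stepFun v A ξ) :
    (Nat.card (annihilator hMH) : ℝ≥0∞) * ‖perOp hMH F‖ₑ ^ 2 =
      ∫⁻ ξ in A, ‖∑ ν : annihilator hMH, g (ξ * ν) * v ν‖ₑ ^ 2 ∂(dualHaar H) := by
  set r := Nat.card (annihilator hMH) with hr
  have hr0 : (r : ℝ≥0∞) ≠ 0 := Nat.cast_ne_zero.mpr Nat.card_pos.ne'
  have hrt : (r : ℝ≥0∞) ≠ ∞ := ENNReal.natCast_ne_top r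
  have hrn : ‖(r : ℂ)‖ₑ = r := by
    rw [← ofReal_norm, Complex.norm_natCast, ENNReal.ofReal_natCast]
  have key : ∀ᵐ ξ ∂(dualHaar H).restrict Ω, ∀ ν : annihilator hMH, ‖perOp hMH F (ξ * ν)‖ₑ ^ 2 =
      A.indicator (fun ξ => (r : ℝ≥0∞)⁻¹ ^ 2 * ‖∑ ν : annihilator hMH, g (ξ * ν) * v ν‖ₑ ^ 2) ξ := by
    refine (ae_restrict_iff' hΩ.measurableSet).mpr ?_
    filter_upwards [ae_translates hMH (perOp_coeFn hMH F), ae_translates hMH hF] with ξ h1 h2 hξ ν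
    have h3 : ∑ ν' : annihilator hMH, F (ξ * ν * ν') = ∑ ν' : annihilator hMH, F (ξ * ν') := by
      rw [← Equiv.sum_comp (Equiv.mulLeft ν) (fun ν' => F (ξ * ν'))]
      simp only [Equiv.coe_mulLeft, Subgroup.coe_mul, mul_assoc]
    have h4 : ∑ ν' : annihilator hMH, F (ξ * ν') =
        A.indicator (fun ξ => ∑ ν : annihilator hMH, g (ξ * ν) * v ν) ξ := by
      by_cases h : ξ ∈ A
      · rw [Set.indicator_of_mem h]
        refine Finset.sum_congr rfl fun ν' _ => ?_
        rw [h2, hΩ.stepFun_mul v hAΩ hξ, Set.indicator_of_mem h]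
      · rw [Set.indicator_of_notMem h]
        refine Finset.sum_eq_zero fun ν' _ => ?_
        rw [h2, hΩ.stepFun_mul v hAΩ hξ, Set.indicator_of_notMem h, mul_zero]
    rw [h1 ν, h3, h4, enorm_mul, mul_pow, enorm_inv (card_annihilator_ne_zero hMH)]
    by_cases h : ξ ∈ A
    · rw [Set.indicator_of_mem h, Set.indicator_of_mem h, ← hr, hrn]
    · simp [h]
  rw [enorm_sq_eq_lintegral, hΩ.lintegral_eq_sum]
  have h5 : ∀ ν : annihilator hMH, ∫⁻ ξ in Ω, ‖perOp hMH F (ξ * ν)‖ₑ ^ 2 ∂(dualHaar H) =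
      (r : ℝ≥0∞)⁻¹ ^ 2 * ∫⁻ ξ in A, ‖∑ ν : annihilator hMH, g (ξ * ν) * v ν‖ₑ ^ 2 ∂(dualHaar H) := by
    intro ν
    rw [lintegral_congr_ae (key.mono fun ξ h => h ν), lintegral_indicator hA,
      Measure.restrict_restrict hA, Set.inter_eq_self_of_subset_left hAΩ, lintegral_const_mul']
    exact ENNReal.pow_ne_top (ENNReal.inv_ne_top.mpr hr0)
  simp only [h5]
  rw [Finset.sum_const, Finset.card_univ, ← Nat.card_eq_fintype_card, ← hr, nsmul_eq_mul,
    ← mul_assoc, ← mul_assoc, mul_comm (r * r : ℝ≥0∞), sq, mul_assoc _ _ (r * r : ℝ≥0∞),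
    ← mul_assoc _ (r : ℝ≥0∞) (r : ℝ≥0∞), ENNReal.inv_mul_cancel hr0 hrt, one_mul,
    ENNReal.inv_mul_cancel hr0 hrt, one_mul]

end Sections

/-! ### The synthesis operator of a Riesz sequence and the samples. -/

section Synthesis

variable {G : Type*} [AddCommGroup G] [TopologicalSpace G] {H : AddSubgroup G}
  [DiscreteTopology H] {E : Type*} [NormedAddCommGroup E] [InnerProductSpace ℂ E]
  [CompleteSpace E]

/-- The upper Riesz bound gives unconditional convergence for square summable coefficients, and
the Riesz bounds pass to the limit. -/
lemma IsRieszSequence.exists_bounds {ι : Type*} {u : ι → E} (hu : IsRieszSequence u) :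
    ∃ A B : ℝ, 0 < A ∧ 0 < B ∧ ∀ (α : ι → ℂ) (S : ℝ), HasSum (fun i => ‖α i‖ ^ 2) S →
      Summable (fun i => α i • u i) ∧ A * S ≤ ‖∑' i, α i • u i‖ ^ 2 ∧
        ‖∑' i, α i • u i‖ ^ 2 ≤ B * S := by
  classical
  obtain ⟨A, B, hA, hB, hAB⟩ := hu
  refine ⟨A, B, hA, hB, fun α S hS => ?_⟩
  have hfin : ∀ t : Finset ι, A * ∑ i ∈ t, ‖α i‖ ^ 2 ≤ ‖∑ i ∈ t, α i • u i‖ ^ 2 ∧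
      ‖∑ i ∈ t, α i • u i‖ ^ 2 ≤ B * ∑ i ∈ t, ‖α i‖ ^ 2 := by
    intro t
    have h := hAB (Finsupp.onFinset t (fun i => if i ∈ t then α i else 0) (by
      intro i; contrapose!; intro hi; rw [if_neg hi]))
    rw [Finsupp.onFinset_sum _ (by simp), Finsupp.onFinset_sum _ (by simp)] at h
    have h1 : ∑ i ∈ t, ‖if i ∈ t then α i else 0‖ ^ 2 = ∑ i ∈ t, ‖α i‖ ^ 2 :=
      Finset.sum_congr rfl fun i hi => by rw [if_pos hi]
    have h2 : ∑ i ∈ t, (if i ∈ t then α i else 0) • u i = ∑ i ∈ t, α i • u i :=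
      Finset.sum_congr rfl fun i hi => by rw [if_pos hi]
    rwa [h1, h2] at h
  have hsum : Summable (fun i => α i • u i) := by
    rw [summable_iff_vanishing_norm]
    intro ε hε
    -- The upper Riesz bound turns a tail below $\varepsilon^2/B$ into a vector of squared norm
    -- below $\varepsilon^2$.
    obtain ⟨s, hs⟩ := summable_iff_vanishing_norm.mp hS.summable (ε ^ 2 / B) (by positivity)
    refine ⟨s, fun t ht => ?_⟩
    have h1 := hs t ht
    rw [Real.norm_of_nonneg (Finset.sum_nonneg fun i _ => by positivity), lt_div_iff₀ hB] at h1
    refine lt_of_pow_lt_pow_left₀ 2 hε.le ((hfin t).2.trans_lt ?_)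
    rwa [mul_comm]
  have h1 : Filter.Tendsto (fun t : Finset ι => ‖∑ i ∈ t, α i • u i‖ ^ 2) Filter.atTop
      (nhds (‖∑' i, α i • u i‖ ^ 2)) := (hsum.hasSum.norm).pow 2
  exact ⟨hsum, le_of_tendsto_of_tendsto' (hS.const_mul A) h1 fun t => (hfin t).1,
    le_of_tendsto_of_tendsto' h1 (hS.const_mul B) fun t => (hfin t).2⟩

variable {ρ : Multiplicative G →* (E ≃L[ℂ] E)} {a : E}

lemma summable_synth (ha : IsRieszSequence fun h : H => op ρ h a) (F : Lp ℂ 2 (dualHaar H)) :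
    Summable fun h : H => ⟪chiL2 H h, F⟫_ℂ • op ρ h a := by
  obtain ⟨A, B, -, -, h⟩ := ha.exists_bounds
  exact (h _ _ (hasSum_norm_inner_chiL2 F)).1

/-- The map `synth` as a bounded operator. -/
def synthOp (ha : IsRieszSequence fun h : H => op ρ h a) : Lp ℂ 2 (dualHaar H) →L[ℂ] E :=
  LinearMap.mkContinuousOfExistsBound
    { toFun := synth ρ H a
      map_add' := fun F F' => by
        simp only [synth, inner_add_right, add_smul]
        exact (summable_synth ha F).tsum_add (summable_synth ha F')
      map_smul' := fun c F => by
        simp only [synth, inner_smul_right, mul_smul, RingHom.id_apply]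
        exact (summable_synth ha F).tsum_const_smul c }
    (by
      obtain ⟨A, B, hA, hB, h⟩ := ha.exists_bounds
      refine ⟨√B, fun F => ?_⟩
      have h1 := (h _ _ (hasSum_norm_inner_chiL2 F)).2.2
      refine le_of_sq_le_sq ?_ (by positivity)
      rw [mul_pow, Real.sq_sqrt hB.le]
      exact h1)

lemma synthOp_apply (ha : IsRieszSequence fun h : H => op ρ h a) (F : Lp ℂ 2 (dualHaar H)) :
    synthOp ha F = synth ρ H a F := rfl

/-- This is the lower Riesz bound; it yields injectivity and closed range. -/
lemma exists_antilipschitz_synthOp (ha : IsRieszSequence fun h : H => op ρ h a) :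
    ∃ K, AntilipschitzWith K (synthOp ha) := by
  obtain ⟨A, B, hA, hB, h⟩ := ha.exists_bounds
  refine ⟨⟨(√A)⁻¹, by positivity⟩, AddMonoidHomClass.antilipschitz_of_bound _ fun F => ?_⟩
  have h1 := (h _ _ (hasSum_norm_inner_chiL2 F)).2.1
  have h2 : √A * ‖F‖ ≤ ‖synthOp ha F‖ := by
    refine le_of_sq_le_sq ?_ (by positivity)
    rw [mul_pow, Real.sq_sqrt hA.le]
    exact h1
  change ‖F‖ ≤ (√A)⁻¹ * ‖synthOp ha F‖
  rwa [← div_eq_inv_mul, le_div_iff₀' (by positivity)]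

lemma synthOp_chiL2 (ha : IsRieszSequence fun h : H => op ρ h a) (h : H) :
    synthOp ha (chiL2 H h) = op ρ h a := by
  classical
  rw [synthOp_apply, synth, tsum_eq_single h]
  · rw [orthonormal_iff_ite.mp orthonormal_chiL2, if_pos rfl, one_smul]
  · intro k hk
    rw [orthonormal_iff_ite.mp orthonormal_chiL2, if_neg hk, zero_smul]

lemma range_synthOp (ha : IsRieszSequence fun h : H => op ρ h a) :
    (synthOp ha).range = genSubspace ρ H a := by
  apply le_antisymm
  · rintro _ ⟨F, rfl⟩
    refine (Submodule.isClosed_topologicalClosure _).mem_of_tendsto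
      (summable_synth ha F).hasSum (Filter.Eventually.of_forall fun t => ?_)
    exact Submodule.le_topologicalClosure _ (Submodule.sum_mem _ fun h _ =>
      Submodule.smul_mem _ _ (Submodule.subset_span ⟨h, rfl⟩))
  · refine Submodule.topologicalClosure_minimal _ (Submodule.span_le.mpr ?_) ?_
    · rintro _ ⟨h, rfl⟩
      exact ⟨chiL2 H h, synthOp_chiL2 ha h⟩
    · obtain ⟨K, hK⟩ := exists_antilipschitz_synthOp ha
      exact hK.isClosed_range (synthOp ha).uniformContinuous

lemma synthOp_mem (ha : IsRieszSequence fun h : H => op ρ h a) (F : Lp ℂ 2 (dualHaar H)) :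
    synthOp ha F ∈ genSubspace ρ H a := range_synthOp ha ▸ ⟨F, rfl⟩

lemma exists_synthOp_eq (ha : IsRieszSequence fun h : H => op ρ h a) {x : E}
    (hx : x ∈ genSubspace ρ H a) : ∃ F, synthOp ha F = x := by
  rwa [← range_synthOp ha] at hx

lemma injective_synthOp (ha : IsRieszSequence fun h : H => op ρ h a) :
    Function.Injective (synthOp ha) :=
  let ⟨_, hK⟩ := exists_antilipschitz_synthOp ha
  hK.injective

/-- Every bounded functional on `L²` is represented through `synthOp` by a vector of the generated
subspace. -/
lemma exists_forall_inner_synthOp_eq (ha : IsRieszSequence fun h : H => op ρ h a) :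
    ∃ C : ℝ, ∀ F : Lp ℂ 2 (dualHaar H), ∃ x ∈ genSubspace ρ H a, ‖x‖ ≤ C * ‖F‖ ∧
      ∀ F', ⟪synthOp ha F', x⟫_ℂ = ⟪F', F⟫_ℂ := by
  have hcl : IsClosed (Set.range (synthOp ha)) := by
    obtain ⟨K, hK⟩ := exists_antilipschitz_synthOp ha
    exact hK.isClosed_range (synthOp ha).uniformContinuous
  have hV : IsClosed ((synthOp ha).range : Set E) := hcl
  have : CompleteSpace (synthOp ha).range := hV.completeSpace_coe
  -- The representing vector is $S^*F$, where $S$ is the inverse of the synthesis operator on its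
  -- closed range.
  let e := (synthOp ha).equivRange (injective_synthOp ha) hcl
  let S : (synthOp ha).range →L[ℂ] Lp ℂ 2 (dualHaar H) := e.symm
  refine ⟨‖ContinuousLinearMap.adjoint S‖, fun F => ⟨ContinuousLinearMap.adjoint S F, ?_, ?_, ?_⟩⟩
  · rw [← range_synthOp ha]
    exact (ContinuousLinearMap.adjoint S F).2
  · exact (ContinuousLinearMap.adjoint S).le_opNorm F
  · intro F'
    have h1 := ContinuousLinearMap.adjoint_inner_right S (e F') F
    rw [show S (e F') = F' from e.symm_apply_apply F'] at h1
    exact h1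

omit [TopologicalSpace G] [CompleteSpace E] in
lemma op_add (g g' : G) (x : E) : op ρ (g + g') x = op ρ g (op ρ g' x) := by
  simp only [op, ofAdd_add, map_mul]
  rfl

lemma synthOp_mulOp_chi (ha : IsRieszSequence fun h : H => op ρ h a) (h : H)
    (F : Lp ℂ 2 (dualHaar H)) :
    synthOp ha (mulOp (chi H h) (memLp_chi h) F) = op ρ h (synthOp ha F) := by
  have : synthOp ha ∘L mulOp (chi H h) (memLp_chi h) = op ρ h ∘L synthOp ha := by
    refine clm_ext_chiL2 fun k => ?_
    rw [ContinuousLinearMap.comp_apply, ContinuousLinearMap.comp_apply, mulOp_chi_chiL2,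
      synthOp_chiL2, synthOp_chiL2, AddSubgroup.coe_add, op_add]
  exact DFunLike.congr_fun this F

omit [TopologicalSpace G] in
lemma sample_eq (b x : E) (g : G) : sample ρ b x g = ⟪b, op ρ (-g) x⟫_ℂ := by
  rw [sample, ContinuousLinearMap.adjoint_inner_left]

/-- The samples of $a$ are conjugated Fourier coefficients, at $-k$, of the adjoint of the synthesis
operator applied to $b$, hence square summable. -/
lemma hasSum_sampleFun (ha : IsRieszSequence fun h : H => op ρ h a) (b : E) :
    HasSum (fun k : H => sample ρ b a k • chiL2 H k) (sampleFun ρ H a b) := by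
  let w := ContinuousLinearMap.adjoint (synthOp ha) b
  have hs : ∀ k : H, sample ρ b a k = ⟪w, chiL2 H (-k)⟫_ℂ := fun k => by
    rw [sample_eq, ContinuousLinearMap.adjoint_inner_left, synthOp_chiL2]; rfl
  refine Summable.hasSum ?_
  have hsq : Summable fun k : H => ‖sample ρ b a k‖ ^ 2 := by
    have := (Equiv.neg H).summable_iff.mpr (hasSum_norm_inner_chiL2 w).summable
    refine this.congr fun k => ?_
    rw [hs, Function.comp_apply, Equiv.neg_apply, norm_inner_symm]
  have hmem : Memℓp (fun k : H => sample ρ b a k) 2 := by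
    refine memℓp_gen ?_
    simpa using hsq
  have := ((chiBasis H).hasSum_repr_symm ⟨_, hmem⟩).summable
  simpa using this

lemma inner_chiL2_sampleFun (ha : IsRieszSequence fun h : H => op ρ h a) (b : E) (k : H) :
    ⟪chiL2 H k, sampleFun ρ H a b⟫_ℂ = sample ρ b a k := by
  classical
  have h4 := (hasSum_sampleFun ha b).mapL (innerSL ℂ (chiL2 H k))
  simp only [innerSL_apply_apply, inner_smul_right, orthonormal_iff_ite.mp orthonormal_chiL2] at h4
  refine h4.unique ?_
  convert! hasSum_ite_eq k (sample ρ b a k) using 2 with k'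
  by_cases hk : k = k'
  · subst hk; rw [if_pos rfl, if_pos rfl, mul_one]
  · rw [if_neg hk, if_neg (Ne.symm hk), mul_zero]

/-- The samples of `synthOp F` are Fourier coefficients of the product of `F` and `sampleFun`. -/
lemma sample_synthOp (ha : IsRieszSequence fun h : H => op ρ h a) {b : E} {γ : Dual H → ℂ}
    (hγ : γ =ᵐ[dualHaar H] sampleFun ρ H a b) (hγ_bdd : MemLp γ ∞ (dualHaar H)) (k : H)
    (F : Lp ℂ 2 (dualHaar H)) :
    sample ρ b (synthOp ha F) k = ⟪chiL2 H k, mulOp γ hγ_bdd F⟫_ℂ := by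
  have hL : linftyToL2 H γ hγ_bdd = sampleFun ρ H a b :=
    Lp.ext ((hγ_bdd.mono_exponent (le_top : 2 ≤ ∞)).coeFn_toLp.trans hγ)
  -- On $\chi_h$ the left side is $\mathcal La(k-h)$ by the group law, and the right side is the
  -- coefficient of $\gamma$ at $k-h$.
  have : innerSL ℂ b ∘L op ρ (-k) ∘L synthOp ha = innerSL ℂ (chiL2 H k) ∘L mulOp γ hγ_bdd := by
    refine clm_ext_chiL2 fun h => ?_
    simp only [ContinuousLinearMap.comp_apply, innerSL_apply_apply, synthOp_chiL2]
    rw [← linftyToL2_chi h, mulOp_linftyToL2_comm, hL, ← neg_neg h, ← inner_mulOp_chi_left,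
      mulOp_chi_chiL2, inner_chiL2_sampleFun ha, sample_eq, neg_neg, ← op_add]
    congr 3
    simp
  rw [sample_eq]
  exact DFunLike.congr_fun this F

end Synthesis

/-! ### Smallest eigenvalue and pseudo-inverse of a matrix. -/

section MatrixBounds

variable {m n : Type*} [Fintype m] [Fintype n]

lemma sum_norm_sq_eq_star_dotProduct (w : m → ℂ) :
    ((∑ i, ‖w i‖ ^ 2 : ℝ) : ℂ) = star w ⬝ᵥ w := by
  rw [dotProduct, Complex.ofReal_sum]
  refine Finset.sum_congr rfl fun i _ => ?_
  rw [Pi.star_apply, RCLike.star_def, Complex.conj_mul', Complex.ofReal_pow]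

lemma sum_norm_sq_mulVec (A : Matrix m n ℂ) (v : n → ℂ) :
    ((∑ i, ‖(A *ᵥ v) i‖ ^ 2 : ℝ) : ℂ) = star v ⬝ᵥ ((Aᴴ * A) *ᵥ v) := by
  rw [sum_norm_sq_eq_star_dotProduct, Matrix.star_mulVec, ← Matrix.mulVec_mulVec,
    Matrix.dotProduct_mulVec (star v)]

/-- Expanding $v$ in an orthonormal eigenbasis of $A^*A$ makes $\|Av\|^2$ the sum of squared
coordinates weighted by eigenvalues. -/
lemma lambdaMin_mul_le (A : Matrix m n ℂ) (v : n → ℂ) :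
    lambdaMin A * ∑ j, ‖v j‖ ^ 2 ≤ ∑ i, ‖(A *ᵥ v) i‖ ^ 2 := by
  classical
  let hB := Matrix.isHermitian_conjTranspose_mul_self A
  let b := hB.eigenvectorBasis
  let x : EuclideanSpace ℂ n := WithLp.toLp 2 v
  have h1 : ∑ j, ‖v j‖ ^ 2 = ∑ i, ‖⟪b i, x⟫_ℂ‖ ^ 2 := by
    rw [b.sum_sq_norm_inner_right, EuclideanSpace.norm_sq_eq]
  let y : EuclideanSpace ℂ n := WithLp.toLp 2 ((Aᴴ * A) *ᵥ v)
  have h2 : ∀ i, ⟪b i, y⟫_ℂ = hB.eigenvalues i * ⟪b i, x⟫_ℂ := by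
    intro i
    rw [EuclideanSpace.inner_eq_star_dotProduct, EuclideanSpace.inner_eq_star_dotProduct,
      dotProduct_comm, dotProduct_comm _ (star _)]
    change star (b i).ofLp ⬝ᵥ ((Aᴴ * A) *ᵥ v) = _ * (star (b i).ofLp ⬝ᵥ v)
    have h3 : (Aᴴ * A) *ᵥ (b i).ofLp = hB.eigenvalues i • (b i).ofLp :=
      hB.mulVec_eigenvectorBasis i
    have h4 : star (b i).ofLp ᵥ* (Aᴴ * A) = star ((Aᴴ * A) *ᵥ (b i).ofLp) := by
      rw [Matrix.star_mulVec, hB.eq]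
    rw [Matrix.dotProduct_mulVec, h4, h3, star_smul, smul_dotProduct]
    simp
  have h5 : ∑ i, ‖(A *ᵥ v) i‖ ^ 2 = ∑ i, hB.eigenvalues i * ‖⟪b i, x⟫_ℂ‖ ^ 2 := by
    apply Complex.ofReal_injective
    rw [sum_norm_sq_mulVec, dotProduct_comm]
    change ⟪x, y⟫_ℂ = _
    rw [← b.sum_inner_mul_inner x y, Complex.ofReal_sum]
    refine Finset.sum_congr rfl fun i _ => ?_
    rw [h2, ← inner_conj_symm x (b i), Complex.ofReal_mul, Complex.ofReal_pow,
      ← Complex.conj_mul']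
    ring
  rw [h1, h5, Finset.mul_sum]
  refine Finset.sum_le_sum fun i _ => mul_le_mul_of_nonneg_right ?_ (by positivity)
  exact ciInf_le (Set.finite_range _).bddBelow i

/-- Tested on unit eigenvectors. `Nonempty` matters: with no columns the hypothesis holds for every
$\delta$, while the empty infimum is $0$. -/
lemma le_lambdaMin [Nonempty n] {A : Matrix m n ℂ} {δ : ℝ}
    (h : ∀ v : n → ℂ, δ * ∑ j, ‖v j‖ ^ 2 ≤ ∑ i, ‖(A *ᵥ v) i‖ ^ 2) : δ ≤ lambdaMin A := by
  classical
  refine le_ciInf fun i => ?_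
  let hB := Matrix.isHermitian_conjTranspose_mul_self A
  have h1 := h (hB.eigenvectorBasis i).ofLp
  have h2 : ∑ j, ‖(hB.eigenvectorBasis i).ofLp j‖ ^ 2 = 1 := by
    rw [← EuclideanSpace.norm_sq_eq, hB.eigenvectorBasis.orthonormal.1 i, one_pow]
  have h3 : hB.eigenvalues i = ∑ j, ‖(A *ᵥ (hB.eigenvectorBasis i).ofLp) j‖ ^ 2 := by
    rw [hB.eigenvalues_eq, ← sum_norm_sq_mulVec]
    exact Complex.ofReal_re _
  rw [h2, mul_one, ← h3] at h1
  exact h1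

/-- A row of the pseudo-inverse `(Aᴴ A)⁻¹ Aᴴ`. -/
def pinvRow [DecidableEq n] (A : Matrix m n ℂ) (k : n) : m → ℂ :=
  star (A *ᵥ ((Aᴴ * A)⁻¹ *ᵥ Pi.single k 1))

/-- Let $u=(A^*A)^{-1}e_k$ and $S=\|Au\|^2=\langle A^*Au,u\rangle=|u_k|$. Then $\delta
S^2\le\delta\|u\|^2\le S$, so $S\le\delta^{-1}$; the row consists of the conjugated entries of $Au$.
-/
lemma pinvRow_spec [DecidableEq n] {A : Matrix m n ℂ} {δ : ℝ} (hδ : 0 < δ)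
    (h : ∀ v : n → ℂ, δ * ∑ j, ‖v j‖ ^ 2 ≤ ∑ i, ‖(A *ᵥ v) i‖ ^ 2) (k : n) :
    pinvRow A k ᵥ* A = Pi.single k 1 ∧ ∀ i, ‖pinvRow A k i‖ ^ 2 ≤ δ⁻¹ := by
  have hinj : Function.Injective (Aᴴ * A).mulVec := by
    rw [← Matrix.coe_mulVecLin, injective_iff_map_eq_zero]
    intro v hv
    rw [Matrix.mulVecLin_apply] at hv
    have h1 := sum_norm_sq_mulVec A v
    rw [hv, dotProduct_zero, Complex.ofReal_eq_zero] at h1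
    have h2 : ∑ j, ‖v j‖ ^ 2 ≤ 0 := by
      have := h v
      rw [h1] at this
      exact nonpos_of_mul_nonpos_right this hδ
    have h3 := (Finset.sum_eq_zero_iff_of_nonneg fun j _ => by positivity).mp
      (h2.antisymm (Finset.sum_nonneg fun j _ => by positivity))
    ext j
    simpa using h3 j (Finset.mem_univ j)
  have hdet : IsUnit (Aᴴ * A).det :=
    (Matrix.isUnit_iff_isUnit_det _).mp (Matrix.mulVec_injective_iff_isUnit.mp hinj)
  set u := (Aᴴ * A)⁻¹ *ᵥ Pi.single k 1 with hu
  have hBu : (Aᴴ * A) *ᵥ u = Pi.single k 1 := by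
    rw [hu, Matrix.mulVec_mulVec, Matrix.mul_nonsing_inv _ hdet, Matrix.one_mulVec]
  refine ⟨?_, fun i => ?_⟩
  · have h1 : star (Aᴴ *ᵥ (A *ᵥ u)) = pinvRow A k ᵥ* A := by
      rw [Matrix.star_mulVec, Matrix.conjTranspose_conjTranspose]; rfl
    rw [← h1, Matrix.mulVec_mulVec, hBu]
    ext j
    by_cases hj : j = k
    · subst hj; simp
    · simp [hj]
  · set S := ∑ i, ‖(A *ᵥ u) i‖ ^ 2 with hS
    have hSk : ((S : ℝ) : ℂ) = star (u k) := by
      rw [hS, sum_norm_sq_mulVec, hBu, dotProduct_single, mul_one, Pi.star_apply]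
    have hS0 : 0 ≤ S := Finset.sum_nonneg fun i _ => by positivity
    have hSn : S = ‖u k‖ := by
      rw [← norm_star (u k), ← hSk, Complex.norm_real, Real.norm_of_nonneg hS0]
    have h1 : δ * S ^ 2 ≤ S := by
      refine le_trans (mul_le_mul_of_nonneg_left ?_ hδ.le) (h u)
      rw [hSn]
      exact Finset.single_le_sum (f := fun j => ‖u j‖ ^ 2) (fun j _ => by positivity)
        (Finset.mem_univ k)
    have h2 : S ≤ δ⁻¹ := by
      rcases hS0.eq_or_lt with h0 | h0
      · rw [← h0]; positivity
      · rw [← one_div, le_div_iff₀ hδ]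
        nlinarith
    refine le_trans ?_ h2
    rw [hS]
    have h3 : ‖pinvRow A k i‖ = ‖(A *ᵥ u) i‖ := norm_star _
    rw [h3]
    exact Finset.single_le_sum (f := fun i => ‖(A *ᵥ u) i‖ ^ 2) (fun j _ => by positivity)
        (Finset.mem_univ i)

/-- Cramer's formula makes the inverse measurable everywhere: on singular matrices it is zero, in
agreement with $0^{-1}=0$. -/
lemma measurable_pinvRow [DecidableEq n] (k : n) (i : m) :
    Measurable fun A : m → n → ℂ => pinvRow (Matrix.of A) k i := by
  have hc : Continuous fun A : m → n → ℂ => (Matrix.of A)ᴴ * Matrix.of A := by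
    refine Continuous.matrix_mul ?_ ?_
    · exact Continuous.matrix_conjTranspose continuous_id
    · exact continuous_id
  have hinv : ∀ p q, Measurable fun A : m → n → ℂ => ((Matrix.of A)ᴴ * Matrix.of A)⁻¹ p q := by
    intro p q
    simp only [Matrix.inv_def, Ring.inverse_eq_inv', Matrix.smul_apply, smul_eq_mul]
    exact hc.matrix_det.measurable.inv.mul (hc.matrix_adjugate.matrix_elem p q).measurable
  have hent : ∀ j, Measurable fun A : m → n → ℂ => A i j := fun j => by fun_prop
  have heq : (fun A : m → n → ℂ => pinvRow (Matrix.of A) k i) = fun A =>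
      star (∑ j, A i j * ((Matrix.of A)ᴴ * Matrix.of A)⁻¹ j k) := by
    ext A
    simp [pinvRow, Matrix.mulVec, dotProduct]
  rw [heq]
  exact continuous_star.measurable.comp
    (Finset.measurable_fun_sum _ fun j _ => (hent j).mul (hinv j k))

end MatrixBounds

/-! ### The matrix of translates and its bounded left inverse. -/

section TranslateMatrix

variable {G : Type*} [AddCommGroup G] [TopologicalSpace G] [IsTopologicalAddGroup G] [T2Space G]
  {H M : AddSubgroup G} [IsUniformLattice H] [IsUniformLattice M] {hMH : M ≤ H}
  {Ω : Set (Dual H)} {s : ℕ} {Γ : Fin s → Dual H → ℂ}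

/-- Replaces eigenvalues by a uniform quadratic lower bound, the form in which (a) is used and
proved. -/
lemma alphaConst_pos_iff :
    0 < alphaConst hMH Γ Ω ↔ ∃ δ : ℝ, 0 < δ ∧ ∀ᵐ ξ ∂(dualHaar H).restrict Ω,
      ∀ v : annihilator hMH → ℂ,
        δ * ∑ ν, ‖v ν‖ ^ 2 ≤ ∑ j, ‖(translateMatrix hMH Γ ξ *ᵥ v) j‖ ^ 2 := by
  constructor
  · intro h
    obtain ⟨δ, hδ0, hδ⟩ := ENNReal.lt_iff_exists_nnreal_btwn.mp h
    refine ⟨δ, by exact_mod_cast hδ0, ?_⟩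
    filter_upwards [ae_essInf_le (μ := (dualHaar H).restrict Ω)
      (f := fun ξ => ENNReal.ofReal (lambdaMin (translateMatrix hMH Γ ξ)))] with ξ hξ v
    refine le_trans ?_ (lambdaMin_mul_le _ v)
    refine mul_le_mul_of_nonneg_right ?_ (Finset.sum_nonneg fun _ _ => by positivity)
    have h1 : (δ : ℝ≥0∞) ≤ ENNReal.ofReal (lambdaMin (translateMatrix hMH Γ ξ)) :=
      hδ.le.trans hξ
    have h2 : 0 < lambdaMin (translateMatrix hMH Γ ξ) :=
      ENNReal.ofReal_pos.mp (hδ0.trans_le h1)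
    rw [← ENNReal.ofReal_coe_nnreal] at h1
    exact (ENNReal.ofReal_le_ofReal_iff h2.le).mp h1
  · rintro ⟨δ, hδ, h⟩
    refine (ENNReal.ofReal_pos.mpr hδ).trans_le (le_essInf_of_ae_le _ ?_)
    filter_upwards [h] with ξ hξ
    exact ENNReal.ofReal_le_ofReal (le_lambdaMin hξ)

/-- Moving $\xi$ by $\nu$ permutes the columns, so lower bounds on $\Omega$ spread to the whole dual
group. -/
lemma translateMatrix_mul_mulVec (ξ : Dual H) (ν : annihilator hMH) (v : annihilator hMH → ℂ) :
    translateMatrix hMH Γ (ξ * ν) *ᵥ v = translateMatrix hMH Γ ξ *ᵥ fun ν' => v (ν⁻¹ * ν') := by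
  ext j
  simp only [translateMatrix, Matrix.mulVec, dotProduct, Matrix.of_apply]
  rw [← Equiv.sum_comp (Equiv.mulLeft ν) (fun ν' => Γ j (ξ * ν') * v (ν⁻¹ * ν'))]
  simp [mul_assoc]

omit [IsTopologicalAddGroup G] [T2Space G] in
lemma aestronglyMeasurable_translate (hΓ : ∀ j, MemLp (Γ j) ∞ (dualHaar H)) (j : Fin s)
    (ν : Dual H) : AEStronglyMeasurable (fun ξ => Γ j (ξ * ν)) (dualHaar H) :=
  (hΓ j).aestronglyMeasurable.comp_measurePreserving (measurePreserving_mul_right' ν)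

lemma IsSection.exists_leftInverse (hΩ : IsSection hMH Ω)
    (hΓ : ∀ j, MemLp (Γ j) ∞ (dualHaar H)) (h : 0 < alphaConst hMH Γ Ω) :
    ∃ F : Fin s → Dual H → ℂ, (∀ j, MemLp (F j) ∞ (dualHaar H)) ∧
      ∀ᵐ ξ ∂(dualHaar H), (fun j => F j ξ) ᵥ* translateMatrix hMH Γ ξ = firstRow hMH := by
  classical
  obtain ⟨δ, hδ, hae⟩ := alphaConst_pos_iff.mp h
  have hall : ∀ᵐ ξ ∂(dualHaar H), ∀ v : annihilator hMH → ℂ,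
      δ * ∑ ν, ‖v ν‖ ^ 2 ≤ ∑ j, ‖(translateMatrix hMH Γ ξ *ᵥ v) j‖ ^ 2 := by
    refine hΩ.ae_of_forall ?_
    filter_upwards [hae] with ξ hξ ν v
    rw [translateMatrix_mul_mulVec]
    refine le_of_eq_of_le ?_ (hξ _)
    rw [← Equiv.sum_comp (Equiv.mulLeft ν⁻¹) (fun ν' => ‖v ν'‖ ^ 2)]
    rfl
  refine ⟨fun j ξ => pinvRow (translateMatrix hMH Γ ξ) 1 j, fun j => ?_, ?_⟩
  · refine memLp_top_of_bound ?_ (√δ⁻¹) ?_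
    · refine AEMeasurable.aestronglyMeasurable ?_
      refine (measurable_pinvRow (n := annihilator hMH) 1 j).comp_aemeasurable
        (f := fun ξ => fun j (ν : annihilator hMH) => Γ j (ξ * ν)) ?_
      exact aemeasurable_pi_lambda _ fun j => aemeasurable_pi_lambda _ fun ν =>
        (aestronglyMeasurable_translate hΓ j ν).aemeasurable
    · filter_upwards [hall] with ξ hξ
      exact Real.le_sqrt_of_sq_le ((pinvRow_spec hδ hξ 1).2 j)
  · filter_upwards [hall] with ξ hξ
    rw [(pinvRow_spec hδ hξ 1).1, firstRow]

end TranslateMatrix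

/-! ### The Cauchy–Schwarz estimate behind the frame bounds. -/

section FrameBounds

lemma hasSum_prod_of_fintype {ι κ V : Type*} [Fintype ι] [AddCommMonoid V] [TopologicalSpace V]
    [ContinuousAdd V] {f : ι × κ → V} {g : ι → V} (h : ∀ j, HasSum (fun m => f (j, m)) (g j)) :
    HasSum f (∑ j, g j) := by
  classical
  have h1 : ∀ j, HasSum (fun p : ι × κ => if p.1 = j then f p else 0) (g j) := by
    intro j
    have hinj : Function.Injective (fun m : κ => (j, m)) := fun m m' h => congrArg Prod.snd h
    rw [← hinj.hasSum_iff]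
    · simpa [Function.comp_def] using h j
    · rintro ⟨j', m⟩ hp
      rw [if_neg]
      rintro rfl
      exact hp ⟨m, rfl⟩
  simpa using hasSum_sum fun j (_ : j ∈ Finset.univ) => h1 j

/-- Pairing the expansion with $x$ gives $\|x\|^2=\sum l_p\langle C_p,x\rangle$ in the convention of
the text; Cauchy–Schwarz applies to its finite partial sums. -/
lemma norm_sq_sq_le_of_hasSum {ι E : Type*} [NormedAddCommGroup E] [InnerProductSpace ℂ E]
    {l : ι → ℂ} {C : ι → E} {x : E} {S S' : ℝ} (hx : HasSum (fun p => l p • C p) x)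
    (hS : HasSum (fun p => ‖l p‖ ^ 2) S) (hS' : HasSum (fun p => ‖⟪C p, x⟫_ℂ‖ ^ 2) S') :
    (‖x‖ ^ 2) ^ 2 ≤ S * S' := by
  have h1 : HasSum (fun p => l p * ⟪x, C p⟫_ℂ) ⟪x, x⟫_ℂ := by
    simpa [inner_smul_right] using hx.mapL (innerSL ℂ x)
  have h2 : ‖⟪x, x⟫_ℂ‖ = ‖x‖ ^ 2 := by
    rw [inner_self_eq_norm_sq_to_K]; simp
  rw [← h2]
  refine le_of_tendsto (h1.norm.pow 2) (Filter.Eventually.of_forall fun t => ?_)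
  calc ‖∑ p ∈ t, l p * ⟪x, C p⟫_ℂ‖ ^ 2
      ≤ (∑ p ∈ t, ‖l p‖ * ‖⟪C p, x⟫_ℂ‖) ^ 2 := by
        refine pow_le_pow_left₀ (norm_nonneg _) ((norm_sum_le _ _).trans_eq ?_) 2
        exact Finset.sum_congr rfl fun p _ => by rw [norm_mul, norm_inner_symm]
    _ ≤ (∑ p ∈ t, ‖l p‖ ^ 2) * ∑ p ∈ t, ‖⟪C p, x⟫_ℂ‖ ^ 2 := Finset.sum_mul_sq_le_sq_mul_sq _ _ _
    _ ≤ S * S' := mul_le_mul (sum_le_hasSum _ (fun _ _ => by positivity) hS)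
        (sum_le_hasSum _ (fun _ _ => by positivity) hS') (Finset.sum_nonneg fun _ _ => by positivity)
        (hS.nonneg fun _ => by positivity)

end FrameBounds

/-! ### The sampling series transported to $L^2$ of the dual group. -/

section Reconstruction

variable {G : Type*} [AddCommGroup G] [TopologicalSpace G] [IsTopologicalAddGroup G] [T2Space G]
  {H M : AddSubgroup G} [IsUniformLattice H] [IsUniformLattice M] {hMH : M ≤ H}
  {Ω : Set (Dual H)} {s : ℕ} {Γ : Fin s → Dual H → ℂ}
  {E : Type*} [NormedAddCommGroup E] [InnerProductSpace ℂ E] [CompleteSpace E]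
  {ρ : Multiplicative G →* (E ≃L[ℂ] E)} {a : E} {b : Fin s → E}

variable (hMH) in
lemma hasSum_norm_sample_sq (ha : IsRieszSequence fun h : H => op ρ h a)
    (hΓ : ∀ j, Γ j =ᵐ[dualHaar H] sampleFun ρ H a (b j))
    (hΓ_bdd : ∀ j, MemLp (Γ j) ∞ (dualHaar H)) (f : Lp ℂ 2 (dualHaar H)) :
    HasSum (fun p : Fin s × M => ‖sample ρ (b p.1) (synthOp ha f) p.2‖ ^ 2)
      (∑ j, ‖perOp hMH (mulOp (Γ j) (hΓ_bdd j) f)‖ ^ 2) := by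
  refine hasSum_prod_of_fintype fun j => ?_
  convert! hasSum_norm_inner_perOp hMH (mulOp (Γ j) (hΓ_bdd j) f) using 3 with m
  rw [← sample_synthOp ha (hΓ j)]

omit [IsTopologicalAddGroup G] [T2Space G] in
lemma op_synthOp_linftyToL2 (ha : IsRieszSequence fun h : H => op ρ h a) {Φ : Dual H → ℂ}
    (hΦ : MemLp Φ ∞ (dualHaar H)) (m : H) :
    op ρ m (synthOp ha (linftyToL2 H Φ hΦ)) = synthOp ha (mulOp Φ hΦ (chiL2 H m)) := by
  rw [← synthOp_mulOp_chi, mulOp_linftyToL2_comm, linftyToL2_chi]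

variable (hMH) in
/-- The sampling series, evaluated in `L²` of the dual group. -/
lemma hasSum_sample_smul (ha : IsRieszSequence fun h : H => op ρ h a)
    (hΓ : ∀ j, Γ j =ᵐ[dualHaar H] sampleFun ρ H a (b j))
    (hΓ_bdd : ∀ j, MemLp (Γ j) ∞ (dualHaar H)) {Φ : Fin s → Dual H → ℂ}
    (hΦ : ∀ j, MemLp (Φ j) ∞ (dualHaar H)) (f : Lp ℂ 2 (dualHaar H)) :
    HasSum (fun p : Fin s × M => sample ρ (b p.1) (synthOp ha f) p.2 •
        op ρ p.2 (synthOp ha (linftyToL2 H (Φ p.1) (hΦ p.1))))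
      (synthOp ha (∑ j, mulOp (Φ j) (hΦ j) (perOp hMH (mulOp (Γ j) (hΓ_bdd j) f)))) := by
  rw [map_sum]
  refine hasSum_prod_of_fintype fun j => ?_
  have h1 := ((hasSum_perOp hMH (mulOp (Γ j) (hΓ_bdd j) f)).mapL (mulOp (Φ j) (hΦ j))).mapL
    (synthOp ha)
  convert! h1 using 2 with m
  rw [map_smul, map_smul, ← sample_synthOp ha (hΓ j), ← op_synthOp_linftyToL2]

/-- The factor $r$ in $\Phi_j=rF_j$ cancels the $r^{-1}$ of the average; exchanging the sums over
$j$ and $\nu$ leaves the row $F\,\mathbb G$. -/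
lemma sum_mulOp_perOp_coeFn (hΓ_bdd : ∀ j, MemLp (Γ j) ∞ (dualHaar H)) {F : Fin s → Dual H → ℂ}
    {Φ : Fin s → Dual H → ℂ} (hΦ : ∀ j, MemLp (Φ j) ∞ (dualHaar H))
    (hΦF : ∀ j ξ, Φ j ξ = (Nat.card (annihilator hMH) : ℂ) * F j ξ) (f : Lp ℂ 2 (dualHaar H)) :
    ∀ᵐ ξ ∂(dualHaar H),
      (∑ j, mulOp (Φ j) (hΦ j) (perOp hMH (mulOp (Γ j) (hΓ_bdd j) f)) : Lp ℂ 2 (dualHaar H)) ξ =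
        ∑ ν : annihilator hMH,
          ((fun j => F j ξ) ᵥ* translateMatrix hMH Γ ξ) ν * f (ξ * ν) := by
  have h1 : ∀ j, ∀ᵐ ξ ∂(dualHaar H),
      mulOp (Φ j) (hΦ j) (perOp hMH (mulOp (Γ j) (hΓ_bdd j) f)) ξ =
        F j ξ * ∑ ν : annihilator hMH, Γ j (ξ * ν) * f (ξ * ν) := by
    intro j
    filter_upwards [mulOp_coeFn (hΦ j) (perOp hMH (mulOp (Γ j) (hΓ_bdd j) f)),
      perOp_coeFn hMH (mulOp (Γ j) (hΓ_bdd j) f),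
      ae_translates hMH (mulOp_coeFn (hΓ_bdd j) f)] with ξ h1 h2 h3
    rw [h1, h2, hΦF, Finset.sum_congr rfl fun ν _ => h3 ν]
    field_simp [card_annihilator_ne_zero hMH]
  filter_upwards [ae_all_iff.mpr h1, Lp.coeFn_fun_finsetSum Finset.univ
    (fun j => mulOp (Φ j) (hΦ j) (perOp hMH (mulOp (Γ j) (hΓ_bdd j) f)))] with ξ h1 h4
  rw [h4, Finset.sum_congr rfl fun j _ => h1 j]
  simp only [Matrix.vecMul, dotProduct, translateMatrix, Matrix.of_apply, Finset.sum_mul,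
    Finset.mul_sum]
  rw [Finset.sum_comm]
  simp only [mul_assoc]

end Reconstruction

/-! ### Proofs of the implications. -/

section Equivalences

lemma sum_enorm_sq {ι V : Type*} [NormedAddCommGroup V] (t : Finset ι) (v : ι → V) :
    ∑ i ∈ t, ‖v i‖ₑ ^ 2 = ENNReal.ofReal (∑ i ∈ t, ‖v i‖ ^ 2) := by
  rw [ENNReal.ofReal_sum_of_nonneg fun _ _ => by positivity]
  refine Finset.sum_congr rfl fun i _ => ?_
  rw [ENNReal.ofReal_pow (norm_nonneg _), ofReal_norm]

lemma enorm_sq {V : Type*} [NormedAddCommGroup V] (v : V) :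
    ‖v‖ₑ ^ 2 = ENNReal.ofReal (‖v‖ ^ 2) := by
  rw [ENNReal.ofReal_pow (norm_nonneg _), ofReal_norm]

variable {G : Type*} [AddCommGroup G] [TopologicalSpace G] [IsTopologicalAddGroup G] [T2Space G]
  {H M : AddSubgroup G} [IsUniformLattice H] [IsUniformLattice M] {hMH : M ≤ H}
  {Ω : Set (Dual H)} {s : ℕ} {Γ : Fin s → Dual H → ℂ}

/-- A lower bound for the periodized products gives a lower bound for the matrix. -/
lemma IsSection.alphaConst_pos_of_bound (hΩ : IsSection hMH Ω)
    (hΓ_bdd : ∀ j, MemLp (Γ j) ∞ (dualHaar H)) {c : ℝ} (hc : 0 < c)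
    (h : ∀ f : Lp ℂ 2 (dualHaar H),
      ‖f‖ ^ 2 ≤ c * ∑ j, ‖perOp hMH (mulOp (Γ j) (hΓ_bdd j) f)‖ ^ 2) :
    0 < alphaConst hMH Γ Ω := by
  set r := Nat.card (annihilator hMH) with hr
  have hr0 : (0 : ℝ) < r := Nat.cast_pos.mpr Nat.card_pos
  have hvec : ∀ v : annihilator hMH → ℂ, ∀ᵐ ξ ∂(dualHaar H).restrict Ω,
      r * ∑ ν, ‖v ν‖ ^ 2 ≤ c * ∑ j, ‖(translateMatrix hMH Γ ξ *ᵥ v) j‖ ^ 2 := by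
    intro v
    have hae : (fun _ => (r : ℝ≥0∞) * ∑ ν, ‖v ν‖ₑ ^ 2) ≤ᵐ[(dualHaar H).restrict Ω] fun ξ =>
        ENNReal.ofReal c * ∑ j, ‖(translateMatrix hMH Γ ξ *ᵥ v) j‖ₑ ^ 2 := by
      -- Testing the hypothesis on step functions built from $v$ over arbitrary $A\subseteq\Omega$
      -- compares the integrals over $A$ and hence the integrands.
      refine ae_le_of_forall_setLIntegral_le_of_sigmaFinite measurable_const fun A' hA' _ => ?_
      rw [Measure.restrict_restrict hA']
      set A := A' ∩ Ω
      have hA : MeasurableSet A := hA'.inter hΩ.measurableSet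
      have hAΩ : A ⊆ Ω := Set.inter_subset_right
      let f := linftyToL2 H (stepFun v A) (memLp_stepFun v hA)
      have h1 : ‖f‖ₑ ^ 2 ≤
          ENNReal.ofReal c * ∑ j, ‖perOp hMH (mulOp (Γ j) (hΓ_bdd j) f)‖ₑ ^ 2 := by
        rw [enorm_sq, sum_enorm_sq, ← ENNReal.ofReal_mul hc.le]
        exact ENNReal.ofReal_le_ofReal (h f)
      have h2 : ∀ j, (r : ℝ≥0∞) * ‖perOp hMH (mulOp (Γ j) (hΓ_bdd j) f)‖ₑ ^ 2 =
          ∫⁻ ξ in A, ‖(translateMatrix hMH Γ ξ *ᵥ v) j‖ₑ ^ 2 ∂(dualHaar H) := by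
        intro j
        refine hΩ.enorm_sq_perOp v hA hAΩ (g := Γ j) ?_
        filter_upwards [mulOp_coeFn (hΓ_bdd j) f,
          ((memLp_stepFun v hA).mono_exponent (le_top : 2 ≤ ∞)).coeFn_toLp] with ξ h3 h4
        rw [h3]
        exact congrArg _ h4
      have hmeas : ∀ j : Fin s, AEMeasurable
          (fun ξ => ‖(translateMatrix hMH Γ ξ *ᵥ v) j‖ₑ ^ 2) ((dualHaar H).restrict A) := by
        intro j
        refine AEMeasurable.restrict (AEMeasurable.pow_const (AEMeasurable.enorm ?_) 2)
        exact Finset.aemeasurable_fun_sum _ fun ν _ =>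
          (aestronglyMeasurable_translate hΓ_bdd j ν).aemeasurable.mul_const _
      rw [lintegral_const_mul' _ _ (ENNReal.natCast_ne_top r),
        lintegral_const_mul' _ _ ENNReal.ofReal_ne_top,
        lintegral_finsetSum' _ fun j _ => hmeas j, ← hΩ.enorm_sq_stepFun v hA hAΩ]
      simp only [← h2]
      rw [← Finset.mul_sum, mul_left_comm]
      gcongr
    filter_upwards [hae] with ξ hξ
    rw [sum_enorm_sq, sum_enorm_sq, ← ENNReal.ofReal_mul hc.le, ← ENNReal.ofReal_natCast,
      ← ENNReal.ofReal_mul hr0.le] at hξ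
    exact (ENNReal.ofReal_le_ofReal_iff
      (mul_nonneg hc.le (Finset.sum_nonneg fun _ _ => by positivity))).mp hξ
  refine alphaConst_pos_iff.mpr ⟨r / c, div_pos hr0 hc, ?_⟩
  -- The null set depends on $v$, so a countable dense family of $v$ is taken; the inequality is
  -- closed in $v$.
  filter_upwards [ae_all_iff.mpr fun n => hvec (TopologicalSpace.denseSeq _ n)] with ξ hξ v
  have hcl : IsClosed {v : annihilator hMH → ℂ |
      r * ∑ ν, ‖v ν‖ ^ 2 ≤ c * ∑ j, ‖(translateMatrix hMH Γ ξ *ᵥ v) j‖ ^ 2} := by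
    refine isClosed_le (by fun_prop) ?_
    have : Continuous fun v : annihilator hMH → ℂ => translateMatrix hMH Γ ξ *ᵥ v :=
      continuous_const.matrix_mulVec continuous_id
    fun_prop
  have hv : v ∈ {v : annihilator hMH → ℂ |
      r * ∑ ν, ‖v ν‖ ^ 2 ≤ c * ∑ j, ‖(translateMatrix hMH Γ ξ *ᵥ v) j‖ ^ 2} :=
    hcl.closure_subset_iff.mpr (Set.range_subset_iff.mpr hξ)
      (TopologicalSpace.denseRange_denseSeq _ v)
  rw [div_mul_eq_mul_div, div_le_iff₀' hc]
  exact hv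

/-- If the modulates of `f` by the characters in `M` form a Bessel sequence, then `f` is
essentially bounded. -/
lemma IsSection.exists_ae_norm_le (hΩ : IsSection hMH Ω) {f : Lp ℂ 2 (dualHaar H)} {B : ℝ}
    (hB : 0 ≤ B)
    (h : ∀ (F : Lp ℂ 2 (dualHaar H)) (S : ℝ),
      HasSum (fun m : M => ‖⟪mulOp (chi H ⟨m, hMH m.2⟩) (memLp_chi _) f, F⟫_ℂ‖ ^ 2) S →
        S ≤ B * ‖F‖ ^ 2) :
    ∃ C : ℝ, ∀ᵐ ξ ∂(dualHaar H), ‖f ξ‖ ≤ C := by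
  classical
  set r := Nat.card (annihilator hMH) with hr
  let f' : Lp ℂ 2 (dualHaar H) := (memLp_conj (Lp.memLp f)).toLp
  have hf' : f' =ᵐ[dualHaar H] fun ξ => conj (f ξ) := MemLp.coeFn_toLp _
  have hvec : ∀ ν : annihilator hMH, ∀ᵐ ξ ∂(dualHaar H).restrict Ω, ‖f (ξ * ν)‖ ≤ √(r * B) := by
    intro ν
    have hae : (fun ξ => ‖f (ξ * ν)‖ₑ ^ 2) ≤ᵐ[(dualHaar H).restrict Ω]
        fun _ => (r : ℝ≥0∞) * ENNReal.ofReal B := by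
      refine ae_le_of_forall_setLIntegral_le_of_sigmaFinite ?_ fun A' hA' _ => ?_
      · exact (((Lp.stronglyMeasurable f).measurable.comp
          (measurable_mul_const (ν : Dual H))).enorm).pow_const 2
      rw [Measure.restrict_restrict hA']
      set A := A' ∩ Ω
      have hA : MeasurableSet A := hA'.inter hΩ.measurableSet
      have hAΩ : A ⊆ Ω := Set.inter_subset_right
      -- With a single nonzero entry, the step function is the indicator of the $\nu$-translate of
      -- $A$, and the sum over $M^\perp$ collapses to $|f(\xi\nu)|^2$.
      let v : annihilator hMH → ℂ := Pi.single ν 1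
      let F := linftyToL2 H (stepFun v A) (memLp_stepFun v hA)
      let w := mulOp (stepFun v A) (memLp_stepFun v hA) f'
      have hw : w =ᵐ[dualHaar H] fun ξ => conj (f ξ) * stepFun v A ξ := by
        filter_upwards [mulOp_coeFn (memLp_stepFun v hA) f', hf'] with ξ h1 h2
        rw [h1, h2, mul_comm]
      have hinner : ∀ m : M, ⟪mulOp (chi H ⟨m, hMH m.2⟩) (memLp_chi _) f, F⟫_ℂ =
          ⟪chiL2 H ⟨m, hMH m.2⟩, w⟫_ℂ := by
        intro m
        rw [L2.inner_def, L2.inner_def]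
        refine integral_congr_ae ?_
        filter_upwards [mulOp_coeFn (memLp_chi (⟨m, hMH m.2⟩ : H)) f, hw,
          chiL2_coeFn (⟨m, hMH m.2⟩ : H),
          ((memLp_stepFun v hA).mono_exponent (le_top : 2 ≤ ∞)).coeFn_toLp] with ξ h1 h2 h3 h4
        rw [h1, h2, h3, show F ξ = stepFun v A ξ from h4, RCLike.inner_apply, RCLike.inner_apply,
          map_mul]
        ring
      have h1 : ‖perOp hMH w‖ ^ 2 ≤ B * ‖F‖ ^ 2 := by
        refine h F _ ?_
        simp only [hinner]
        exact hasSum_norm_inner_perOp hMH w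
      have h2 : ‖perOp hMH w‖ₑ ^ 2 ≤ ENNReal.ofReal B * ‖F‖ₑ ^ 2 := by
        rw [enorm_sq, enorm_sq, ← ENNReal.ofReal_mul hB]
        exact ENNReal.ofReal_le_ofReal h1
      have h3 := hΩ.enorm_sq_perOp v hA hAΩ hw
      have h4 : ∀ ξ, ‖∑ ν' : annihilator hMH, conj (f (ξ * ν')) * v ν'‖ₑ ^ 2 =
          ‖f (ξ * ν)‖ₑ ^ 2 := by
        intro ξ
        rw [Finset.sum_eq_single ν (fun ν' _ hne => by simp [v, hne]) (by simp)]
        simp only [v, Pi.single_eq_same, mul_one]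
        rw [← ofReal_norm, RCLike.norm_conj, ofReal_norm]
      have h5 : ∑ ν', ‖v ν'‖ₑ ^ 2 = 1 := by
        rw [Finset.sum_eq_single ν (fun ν' _ hne => by simp [v, hne]) (by simp)]
        simp [v]
      simp only [h4] at h3
      rw [← h3, ← mul_one ((r : ℝ≥0∞) * ENNReal.ofReal B), ← h5,
        lintegral_const_mul' _ _ (ENNReal.mul_ne_top (ENNReal.natCast_ne_top r)
          ENNReal.ofReal_ne_top), ← hΩ.enorm_sq_stepFun v hA hAΩ, mul_assoc]
      gcongr
    filter_upwards [hae] with ξ hξ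
    rw [enorm_sq, ← ENNReal.ofReal_natCast, ← ENNReal.ofReal_mul (Nat.cast_nonneg r)] at hξ
    exact Real.le_sqrt_of_sq_le ((ENNReal.ofReal_le_ofReal_iff (by positivity)).mp hξ)
  exact ⟨√(r * B), hΩ.ae_of_forall (ae_all_iff.mpr hvec)⟩

variable {E : Type*} [NormedAddCommGroup E] [InnerProductSpace ℂ E] [CompleteSpace E]
  {ρ : Multiplicative G →* (E ≃L[ℂ] E)} {a : E} {b : Fin s → E}

/-- Stable reconstruction through a frame bounds the periodized products from below. -/
lemma IsSection.alphaConst_pos_of_frame (hΩ : IsSection hMH Ω)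
    (ha : IsRieszSequence fun h : H => op ρ h a)
    (hΓ : ∀ j, Γ j =ᵐ[dualHaar H] sampleFun ρ H a (b j))
    (hΓ_bdd : ∀ j, MemLp (Γ j) ∞ (dualHaar H)) {C : Fin s × M → E}
    (hC : IsFrameFor C (genSubspace ρ H a))
    (hrec : ∀ x ∈ genSubspace ρ H a,
      HasSum (fun p : Fin s × M => sample ρ (b p.1) x p.2 • C p) x) :
    0 < alphaConst hMH Γ Ω := by
  obtain ⟨-, A, B, hA, hB, hAB⟩ := hC
  obtain ⟨K, hK⟩ := exists_antilipschitz_synthOp ha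
  -- From $\|f\|\le K\|x\|$ and $\|x\|^2\le BS$; the added $1$ keeps the constant positive even if
  -- $K=0$.
  refine hΩ.alphaConst_pos_of_bound hΓ_bdd (c := K ^ 2 * B + 1) (by positivity) fun f => ?_
  set S := ∑ j, ‖perOp hMH (mulOp (Γ j) (hΓ_bdd j) f)‖ ^ 2 with hS
  have hS0 : 0 ≤ S := Finset.sum_nonneg fun _ _ => by positivity
  set x := synthOp ha f with hx
  have hxV := synthOp_mem ha f
  obtain ⟨hsum, -, hle⟩ := hAB x hxV
  have h1 := norm_sq_sq_le_of_hasSum (hrec x hxV) (hasSum_norm_sample_sq hMH ha hΓ hΓ_bdd f)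
    hsum.hasSum
  have h2 : ‖x‖ ^ 2 ≤ B * S := by
    rcases (sq_nonneg ‖x‖).eq_or_lt with h0 | h0
    · rw [← h0]; positivity
    · refine le_of_mul_le_mul_right ?_ h0
      rw [← sq, mul_comm B, mul_assoc]
      exact h1.trans (mul_le_mul_of_nonneg_left hle hS0)
  have h3 : ‖f‖ ≤ K * ‖x‖ := by
    simpa using ZeroHomClass.bound_of_antilipschitz (synthOp ha) hK f
  calc ‖f‖ ^ 2 ≤ (K * ‖x‖) ^ 2 := by gcongr
    _ = K ^ 2 * ‖x‖ ^ 2 := by ring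
    _ ≤ K ^ 2 * (B * S) := by gcongr
    _ ≤ (K ^ 2 * B + 1) * S := by nlinarith

omit [IsTopologicalAddGroup G] [T2Space G] [IsUniformLattice M] in
variable (hMH) in
lemma memLp_card_mul {F : Dual H → ℂ} (hF : MemLp F ∞ (dualHaar H)) :
    MemLp (fun ξ => (Nat.card (annihilator hMH) : ℂ) * F ξ) ∞ (dualHaar H) := hF.const_mul _

omit [IsTopologicalAddGroup G] [T2Space G] [IsUniformLattice M] in
lemma linftyToL2_card_mul {F : Dual H → ℂ} (hF : MemLp F ∞ (dualHaar H)) :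
    linftyToL2 H _ (memLp_card_mul hMH hF) =
      (Nat.card (annihilator hMH) : ℂ) • linftyToL2 H F hF := rfl

/-- A bounded left inverse of the matrix yields a reconstruction frame. -/
lemma exists_frame_of_leftInverse (ha : IsRieszSequence fun h : H => op ρ h a)
    (hΓ : ∀ j, Γ j =ᵐ[dualHaar H] sampleFun ρ H a (b j))
    (hΓ_bdd : ∀ j, MemLp (Γ j) ∞ (dualHaar H)) {F : Fin s → Dual H → ℂ}
    (hF : ∀ j, MemLp (F j) ∞ (dualHaar H))
    (hFΓ : ∀ᵐ ξ ∂(dualHaar H), (fun j => F j ξ) ᵥ* translateMatrix hMH Γ ξ = firstRow hMH) :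
    ∃ c : Fin s → E, (∀ j, c j ∈ genSubspace ρ H a) ∧
      IsFrameFor (fun p : Fin s × M => op ρ p.2 (c p.1)) (genSubspace ρ H a) ∧
      ∀ x ∈ genSubspace ρ H a,
        HasSum (fun p : Fin s × M => sample ρ (b p.1) x p.2 • op ρ p.2 (c p.1)) x := by
  classical
  have hΦ := fun j => memLp_card_mul hMH (hF j)
  set Φ : Fin s → Dual H → ℂ := fun j ξ => (Nat.card (annihilator hMH) : ℂ) * F j ξ with hΦdef
  let c : Fin s → E := fun j => synthOp ha (linftyToL2 H (Φ j) (hΦ j))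
  have hc : ∀ j, c j ∈ genSubspace ρ H a := fun j => synthOp_mem ha _
  have hrec : ∀ f : Lp ℂ 2 (dualHaar H), HasSum (fun p : Fin s × M =>
      sample ρ (b p.1) (synthOp ha f) p.2 • op ρ p.2 (c p.1)) (synthOp ha f) := by
    intro f
    have h1 := hasSum_sample_smul hMH ha hΓ hΓ_bdd hΦ f
    suffices h2 : ∑ j, mulOp (Φ j) (hΦ j) (perOp hMH (mulOp (Γ j) (hΓ_bdd j) f)) = f by
      rw [h2] at h1
      exact h1
    refine Lp.ext ?_
    filter_upwards [sum_mulOp_perOp_coeFn (hMH := hMH) hΓ_bdd hΦ (fun _ _ => rfl) f, hFΓ]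
      with ξ h2 h3
    rw [h2, h3, firstRow, Finset.sum_eq_single 1]
    · simp
    · intro ν _ hν
      rw [Pi.single_eq_of_ne hν, zero_mul]
    · simp
  -- Since $\Pi(m)c_j=T(\Phi_j\chi_m)$, the coefficient $\langle x,\Pi(m)c_j\rangle$ is the $m$-th
  -- Fourier coefficient of $\overline{\Phi_j}\,T^*x$. Boundedness of $D_j$ is thus the Bessel
  -- bound.
  let D : Fin s → E →L[ℂ] Lp ℂ 2 (dualHaar H) := fun j =>
    perOp hMH ∘L mulOp _ (memLp_conj (hΦ j)) ∘L ContinuousLinearMap.adjoint (synthOp ha)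
  have hbess : ∀ x : E, HasSum (fun p : Fin s × M => ‖⟪op ρ p.2 (c p.1), x⟫_ℂ‖ ^ 2)
      (∑ j, ‖D j x‖ ^ 2) := by
    intro x
    refine hasSum_prod_of_fintype fun j => ?_
    convert! hasSum_norm_inner_perOp hMH
      (mulOp _ (memLp_conj (hΦ j)) (ContinuousLinearMap.adjoint (synthOp ha) x)) using 4 with m
    rw [← inner_mulOp_left (hΦ j) (memLp_conj (hΦ j)) (fun _ => rfl),
      ContinuousLinearMap.adjoint_inner_right, ← op_synthOp_linftyToL2]
  obtain ⟨K, hK⟩ := exists_antilipschitz_synthOp ha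
  let R : Fin s → Lp ℂ 2 (dualHaar H) →L[ℂ] Lp ℂ 2 (dualHaar H) := fun j =>
    perOp hMH ∘L mulOp (Γ j) (hΓ_bdd j)
  -- $L$ bounds the sample energy by $L\|x\|^2$, so the Cauchy–Schwarz estimate gives the lower
  -- frame bound $L^{-1}$.
  set L : ℝ := (∑ j, ‖R j‖ ^ 2) * K ^ 2 + 1 with hL
  have hR0 : 0 ≤ ∑ j, ‖R j‖ ^ 2 := Finset.sum_nonneg fun _ _ => by positivity
  have hL0 : 0 < L := by positivity
  refine ⟨c, hc, ⟨fun p => ?_, L⁻¹, ∑ j, ‖D j‖ ^ 2 + 1, by positivity, ?_, fun x hx => ?_⟩, ?_⟩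
  · change op ρ ((⟨p.2, hMH p.2.2⟩ : H) : G) (c p.1) ∈ _
    rw [← synthOp_mulOp_chi ha]
    exact synthOp_mem ha _
  · have : 0 ≤ ∑ j, ‖D j‖ ^ 2 := Finset.sum_nonneg fun _ _ => by positivity
    linarith
  · refine ⟨(hbess x).summable, ?_, ?_⟩
    · obtain ⟨f, rfl⟩ := exists_synthOp_eq ha hx
      set x := synthOp ha f with hxf
      have h1 := norm_sq_sq_le_of_hasSum (hrec f) (hasSum_norm_sample_sq hMH ha hΓ hΓ_bdd f)
        (hbess x).summable.hasSum
      set S' := ∑' p : Fin s × M, ‖⟪op ρ p.2 (c p.1), x⟫_ℂ‖ ^ 2 with hS'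
      have hS'0 : 0 ≤ S' := tsum_nonneg fun _ => by positivity
      have h3 : ‖f‖ ≤ K * ‖x‖ := by
        simpa using ZeroHomClass.bound_of_antilipschitz (synthOp ha) hK f
      have h2 : ∑ j, ‖perOp hMH (mulOp (Γ j) (hΓ_bdd j) f)‖ ^ 2 ≤ L * ‖x‖ ^ 2 := by
        calc ∑ j, ‖perOp hMH (mulOp (Γ j) (hΓ_bdd j) f)‖ ^ 2
            ≤ ∑ j, (‖R j‖ * (K * ‖x‖)) ^ 2 := by
              refine Finset.sum_le_sum fun j _ => pow_le_pow_left₀ (norm_nonneg _) ?_ 2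
              exact ((R j).le_opNorm f).trans (by gcongr)
          _ = (∑ j, ‖R j‖ ^ 2) * K ^ 2 * ‖x‖ ^ 2 := by
              rw [Finset.sum_mul, Finset.sum_mul]
              exact Finset.sum_congr rfl fun j _ => by ring
          _ ≤ L * ‖x‖ ^ 2 := by
              rw [hL]
              nlinarith [sq_nonneg ‖x‖]
      rw [inv_mul_le_iff₀ hL0]
      rcases (sq_nonneg ‖x‖).eq_or_lt with h0 | h0
      · rw [← h0]; positivity
      · refine le_of_mul_le_mul_right ?_ h0
        rw [← sq, mul_right_comm]
        exact h1.trans (mul_le_mul_of_nonneg_right h2 hS'0)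
    · rw [(hbess x).tsum_eq, add_mul, Finset.sum_mul]
      have h1 : ∑ j, ‖D j x‖ ^ 2 ≤ ∑ j, ‖D j‖ ^ 2 * ‖x‖ ^ 2 := Finset.sum_le_sum fun j _ => by
        rw [← mul_pow]
        exact pow_le_pow_left₀ (norm_nonneg _) ((D j).le_opNorm x) 2
      nlinarith [sq_nonneg ‖x‖]
  · intro x hx
    obtain ⟨f, rfl⟩ := exists_synthOp_eq ha hx
    exact hrec f

/-- Every reconstruction frame of translates comes from a bounded left inverse of the matrix. -/
lemma IsSection.exists_leftInverse_of_frame (hΩ : IsSection hMH Ω)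
    (ha : IsRieszSequence fun h : H => op ρ h a)
    (hΓ : ∀ j, Γ j =ᵐ[dualHaar H] sampleFun ρ H a (b j))
    (hΓ_bdd : ∀ j, MemLp (Γ j) ∞ (dualHaar H)) {c : Fin s → E}
    (hc : ∀ j, c j ∈ genSubspace ρ H a)
    (hframe : IsFrameFor (fun p : Fin s × M => op ρ p.2 (c p.1)) (genSubspace ρ H a))
    (hrec : ∀ x ∈ genSubspace ρ H a,
      HasSum (fun p : Fin s × M => sample ρ (b p.1) x p.2 • op ρ p.2 (c p.1)) x) :
    ∃ (F : Fin s → Dual H → ℂ) (hF : ∀ j, MemLp (F j) ∞ (dualHaar H)),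
      (∀ᵐ ξ ∂(dualHaar H), (fun j => F j ξ) ᵥ* translateMatrix hMH Γ ξ = firstRow hMH) ∧
      ∀ j, c j = synth ρ H a
        ((Nat.card (annihilator hMH) : ℂ) • linftyToL2 H (F j) (hF j)) := by
  classical
  choose f hf using fun j => exists_synthOp_eq ha (hc j)
  obtain ⟨-, A, B, hA, hB, hAB⟩ := hframe
  obtain ⟨K, hK⟩ := exists_forall_inner_synthOp_eq ha
  have hbdd : ∀ j, ∃ C : ℝ, ∀ᵐ ξ ∂(dualHaar H), ‖f j ξ‖ ≤ C := by
    intro j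
    -- Only the upper frame bound enters: $F$ is represented by a vector $x\in\mathcal A_a$ with
    -- $\|x\|\le K\|F\|$, which turns pairings with modulates of $f_j$ into frame coefficients of
    -- $x$.
    refine hΩ.exists_ae_norm_le (B := B * K ^ 2) (by positivity) fun F S hS => ?_
    obtain ⟨x, hxV, hxF, hx⟩ := hK F
    obtain ⟨hsum, -, hle⟩ := hAB x hxV
    have h1 : ∀ m : M, ⟪mulOp (chi H ⟨m, hMH m.2⟩) (memLp_chi _) (f j), F⟫_ℂ =
        ⟪op ρ m (c j), x⟫_ℂ := by
      intro m
      rw [← hx, synthOp_mulOp_chi, hf]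
    simp only [h1] at hS
    have hinj : Function.Injective (fun m : M => (j, m)) := fun m m' h => congrArg Prod.snd h
    calc S = ∑' m : M, ‖⟪op ρ m (c j), x⟫_ℂ‖ ^ 2 := hS.tsum_eq.symm
      _ ≤ ∑' p : Fin s × M, ‖⟪op ρ p.2 (c p.1), x⟫_ℂ‖ ^ 2 :=
        hS.summable.tsum_le_tsum_of_inj (fun m : M => (j, m)) hinj (fun _ _ => by positivity)
          (fun _ => le_rfl) hsum
      _ ≤ B * ‖x‖ ^ 2 := hle
      _ ≤ B * (K * ‖F‖) ^ 2 := by gcongr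
      _ = B * K ^ 2 * ‖F‖ ^ 2 := by ring
  have hΦ' : ∀ j, MemLp (f j) ∞ (dualHaar H) := fun j =>
    let ⟨C, hC⟩ := hbdd j
    memLp_top_of_bound (Lp.aestronglyMeasurable _) C hC
  set r : ℂ := (Nat.card (annihilator hMH) : ℂ) with hr
  have hr0 : r ≠ 0 := card_annihilator_ne_zero hMH
  have hF : ∀ j, MemLp (fun ξ => r⁻¹ * f j ξ) ∞ (dualHaar H) := fun j => (hΦ' j).const_mul _
  have hfL : ∀ j, linftyToL2 H (f j) (hΦ' j) = f j := fun j =>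
    Lp.ext (((hΦ' j).mono_exponent (le_top : 2 ≤ ∞)).coeFn_toLp)
  have hrF : ∀ j ξ, f j ξ = r * (r⁻¹ * f j ξ) := fun j ξ => by
    rw [mul_inv_cancel_left₀ hr0]
  refine ⟨fun j ξ => r⁻¹ * f j ξ, hF, ?_, fun j => ?_⟩
  · have hid : ∀ g : Lp ℂ 2 (dualHaar H),
        ∑ j, mulOp (f j) (hΦ' j) (perOp hMH (mulOp (Γ j) (hΓ_bdd j) g)) = g := by
      intro g
      refine injective_synthOp ha ((hasSum_sample_smul hMH ha hΓ hΓ_bdd hΦ' g).unique ?_)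
      simp only [hfL, hf]
      exact hrec _ (synthOp_mem ha g)
    -- The reconstruction identity is applied to the indicator of $\mu\Omega$, which isolates one
    -- column of the matrix.
    have hstep : ∀ μ : annihilator hMH, ∀ᵐ ξ ∂(dualHaar H),
        stepFun (Pi.single μ 1) Ω ξ = ∑ ν : annihilator hMH,
          ((fun j => r⁻¹ * f j ξ) ᵥ* translateMatrix hMH Γ ξ) ν *
            stepFun (Pi.single μ 1) Ω (ξ * ν) := by
      intro μ
      let v : annihilator hMH → ℂ := Pi.single μ 1
      let g := linftyToL2 H (stepFun v Ω) (memLp_stepFun v hΩ.measurableSet)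
      have hg : g =ᵐ[dualHaar H] stepFun v Ω :=
        ((memLp_stepFun v hΩ.measurableSet).mono_exponent (le_top : 2 ≤ ∞)).coeFn_toLp
      have h1 := sum_mulOp_perOp_coeFn (hMH := hMH) hΓ_bdd hΦ' hrF g
      rw [hid g] at h1
      filter_upwards [h1, hg, ae_translates hMH hg] with ξ h1 h2 h3
      rw [← h2, h1]
      exact Finset.sum_congr rfl fun ν _ => by rw [h3]
    refine hΩ.ae_of_forall ((ae_restrict_iff' hΩ.measurableSet).mpr ?_)
    filter_upwards [ae_translates hMH (ae_all_iff.mpr hstep)] with ξ hξ hξΩ ν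
    ext ν'
    -- At the point $\xi\nu$ with $\xi\in\Omega$, the choice $\mu=\nu\nu'$ isolates column $\nu'$;
    -- the left side is $1$ exactly when $\nu'$ is neutral.
    have h1 := hξ ν (ν * ν')
    have h2 : ∀ κ : annihilator hMH, stepFun (Pi.single (ν * ν') 1) Ω (ξ * κ) =
        (Pi.single (ν * ν') 1 : annihilator hMH → ℂ) κ := fun κ => by
      rw [hΩ.stepFun_mul _ subset_rfl hξΩ, Set.indicator_of_mem hξΩ]
    have h3 : ∀ κ : annihilator hMH, stepFun (Pi.single (ν * ν') 1) Ω (ξ * ν * κ) =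
        (Pi.single ν' 1 : annihilator hMH → ℂ) κ := fun κ => by
      rw [mul_assoc, ← Subgroup.coe_mul, h2, Pi.single_apply, Pi.single_apply]
      simp only [mul_right_inj]
    simp only [h3] at h1
    rw [h2, Finset.sum_eq_single ν' (fun κ _ hne => by rw [Pi.single_eq_of_ne hne, mul_zero])
      (by simp), Pi.single_eq_same, mul_one] at h1
    rw [← h1, firstRow, Pi.single_apply, Pi.single_apply]
    simp only [left_eq_mul]
  · rw [← synthOp_apply ha, ← linftyToL2_card_mul, ← hf j]
    congr 1
    rw [← hfL j]
    congr 1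
    ext ξ
    exact hrF j ξ

end Equivalences

end LCASampling

end

open LCASampling in
theorem mainTheorem3
    {G : Type*} [AddCommGroup G] [TopologicalSpace G] [IsTopologicalAddGroup G]
    [LocallyCompactSpace G] [T2Space G] [SecondCountableTopology G]
    (M H : AddSubgroup G) (hMH : M ≤ H) [Countable M] [Countable H]
    [IsUniformLattice M] [IsUniformLattice H]
    {E : Type*} [NormedAddCommGroup E] [InnerProductSpace ℂ E] [CompleteSpace E]
    [TopologicalSpace.SeparableSpace E]
    (ρ : Multiplicative G →* (E ≃L[ℂ] E)) (a : E)
    (ha : IsRieszSequence fun h : H => op ρ h a)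
    (Ω : Set (Dual H)) (hΩ : IsSection hMH Ω)
    (s : ℕ) (b : Fin s → E) (Γ : Fin s → Dual H → ℂ)
    (hΓ : ∀ j, Γ j =ᵐ[dualHaar H] sampleFun ρ H a (b j))
    (hΓ_bdd : ∀ j, MemLp (Γ j) ∞ (dualHaar H)) :
    List.TFAE [
      0 < alphaConst hMH Γ Ω,
      ∃ F : Fin s → Dual H → ℂ, (∀ j, MemLp (F j) ∞ (dualHaar H)) ∧
        ∀ᵐ ξ ∂(dualHaar H), (fun j => F j ξ) ᵥ* translateMatrix hMH Γ ξ = firstRow hMH,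
      ∃ c : Fin s → E, (∀ j, c j ∈ genSubspace ρ H a) ∧
        IsFrameFor (fun p : Fin s × M => op ρ p.2 (c p.1)) (genSubspace ρ H a) ∧
        ∀ x ∈ genSubspace ρ H a,
          HasSum (fun p : Fin s × M => sample ρ (b p.1) x p.2 • op ρ p.2 (c p.1)) x,
      ∃ C : Fin s × M → E, IsFrameFor C (genSubspace ρ H a) ∧
        ∀ x ∈ genSubspace ρ H a,
          HasSum (fun p : Fin s × M => sample ρ (b p.1) x p.2 • C p) x] ∧
    ∀ c : Fin s → E, (∀ j, c j ∈ genSubspace ρ H a) →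
      IsFrameFor (fun p : Fin s × M => op ρ p.2 (c p.1)) (genSubspace ρ H a) →
      (∀ x ∈ genSubspace ρ H a,
        HasSum (fun p : Fin s × M => sample ρ (b p.1) x p.2 • op ρ p.2 (c p.1)) x) →
      ∃ (F : Fin s → Dual H → ℂ) (hF : ∀ j, MemLp (F j) ∞ (dualHaar H)),
        (∀ᵐ ξ ∂(dualHaar H), (fun j => F j ξ) ᵥ* translateMatrix hMH Γ ξ = firstRow hMH) ∧
        ∀ j, c j = synth ρ H a
          ((Nat.card (annihilator hMH) : ℂ) • linftyToL2 H (F j) (hF j)) := by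
  refine ⟨?_, fun c hc hframe hrec =>
    hΩ.exists_leftInverse_of_frame ha hΓ hΓ_bdd hc hframe hrec⟩
  tfae_have 1 → 2 := hΩ.exists_leftInverse hΓ_bdd
  tfae_have 2 → 3 := fun ⟨F, hF, hFΓ⟩ => exists_frame_of_leftInverse ha hΓ hΓ_bdd hF hFΓ
  tfae_have 3 → 4 := fun ⟨c, _, hframe, hrec⟩ => ⟨_, hframe, hrec⟩
  tfae_have 4 → 1 := fun ⟨C, hC, hrec⟩ => hΩ.alphaConst_pos_of_frame ha hΓ hΓ_bdd hC hrec
  tfae_finish
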